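/- **Theorem (Axiomatizability of $\langle\mathbb{Z};<,+\rangle$).** Let $T$ be the theory, in the language $\{<,+,-,\mathbf 0,\mathbf 1\}$, of non-trivial discretely ordered abelian groups with the division algorithm, that is, the theory with the following axioms, where $n\cdot y$ abbreviates $y+\cdots+y$ ($n$ times), $\bar i$ abbreviates $\mathbf 1+\cdots+\mathbf 1$ ($i$ times), $\bar 0=\mathbf 0$, and $a\le b$ abbreviates $a<b\vee a=b$: - $\forall x,y\,(x<y\rightarrow y\not<x)$, - $\forall x,y,z\,(x<y<z\rightarrow x<z)$, - $\forall x,y\,(x<y\vee x=y\vee y<x)$, - $\forall x,y,z\,(x+(y+z)=(x+y)+z)$, - $\forall x\,(x+\mathbf 0=x)$, - $\forall x\,(x+(-x)=\mathbf 0)$, - $\forall x,y\,(x+y=y+x)$, - $\forall x,y,z\,(x<y\rightarrow x+z<y+z)$, - $\forall x,y\,(x<y\leftrightarrow x+\mathbf 1\le y)$, - $\forall x\,\exists y\,\bigvee_{i<n}\,(x=n\cdot y+\bar i)$, for every integer $n\ge 1$. Let $T^{\equiv}$ be the expansion of $T$, in the language $\{<,+,-,\mathbf 0,\mathbf 1\}\cup\{\equiv_n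 : n\ge 2\}$, by the definitions $\forall x,y\,\big(x\equiv_n y\leftrightarrow\exists z\,(x+n\cdot z=y)\big)$ for all integers $n\ge 2$. Then: 1. $T$ completely axiomatizes the order and additive theory of the integers: for every sentence $\varphi$ of the language $\{<,+\}$, and more generally of $\{<,+,-,\mathbf 0,\mathbf 1\}$, $\varphi$ is a consequence of $T$ if and only if $\varphi$ is true in $\mathbb{Z}$. Likewise, a sentence of the language of $T^{\equiv}$ is a consequence of $T^{\equiv}$ if and only if it is true in $\langle\mathbb{Z};<,+,-,0,1,\{\equiv_n\}_{n\ge2}\rangle$, where $\equiv_n$ is congruence modulo $n$. 2. The theory $T^{\equiv}$, and the theory of the structure $\langle\mathbb{Z};<,+,-,0,1,\{\equiv_n\}_{n\ge2}\rangle$, admit quantifier elimination: every formula is equivalent, modulo the theory, to a quantifier-free formula in the same free variables. 3. The theories of the structures $\langle\mathbb{Z};<,+,-,0,1,\{\equiv_n\}_{n\ge2}\rangle$ and $\langle\mathbb{Z};<,+\rangle$ are decidable: there is an algorithm that decides, given (the Gödel number of) a sentence, whether it is true in the structure. -/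

import Mathlib

open FirstOrder

namespace IntOrdAdd

open FirstOrder.Language

/-! ### The three languages -/

/-- The only function symbol of the language `{<, +}`. -/
inductive AddFunc : ℕ → Type
  | add : AddFunc 2

/-- The function symbols `0`, `1`, `-` (unary), `+`. -/
inductive GroupFunc : ℕ → Type
  | zero : GroupFunc 0
  | one : GroupFunc 0
  | neg : GroupFunc 1
  | add : GroupFunc 2

/-- The only relation symbol `<`. -/
inductive OrdRel : ℕ → Type
  | lt : OrdRel 2

/-- The relation symbols `<` and `≡ₙ` for `n ≥ 2`. -/
inductive CongRel : ℕ → Type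
  | lt : CongRel 2
  | cong (n : ℕ) (hn : 2 ≤ n) : CongRel 2

/-- The language `{<, +}`. -/
def LAdd : FirstOrder.Language.{0, 0} := ⟨AddFunc, OrdRel⟩

/-- The language `{<, +, -, 0, 1}`. -/
def LGroup : FirstOrder.Language.{0, 0} := ⟨GroupFunc, OrdRel⟩

/-- The language `{<, +, -, 0, 1} ∪ {≡ₙ : n ≥ 2}`. -/
def LCong : FirstOrder.Language.{0, 0} := ⟨GroupFunc, CongRel⟩

/-- The inclusion `{<, +} ⊆ {<, +, -, 0, 1}`. -/
def addToGroup : LAdd →ᴸ LGroup where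
  onFunction := fun _ f => match f with
    | .add => GroupFunc.add
  onRelation := fun _ r => r

/-- The inclusion `{<, +, -, 0, 1} ⊆ {<, +, -, 0, 1} ∪ {≡ₙ : n ≥ 2}`. -/
def groupToCong : LGroup →ᴸ LCong where
  onFunction := fun _ f => f
  onRelation := fun _ r => match r with
    | .lt => CongRel.lt

/-! ### The integers as a structure for each of the languages -/

/-- The structure `⟨ℤ; <, +⟩`. -/
instance intLAdd : LAdd.Structure ℤ where
  funMap := fun f v => match f, v with
    | .add, v => v 0 + v 1
  RelMap := fun r v => match r, v with
    | .lt, v => v 0 < v 1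

/-- The structure `⟨ℤ; <, +, -, 0, 1⟩`. -/
instance intLGroup : LGroup.Structure ℤ where
  funMap := fun f v => match f, v with
    | .zero, _ => 0
    | .one, _ => 1
    | .neg, v => -(v 0)
    | .add, v => v 0 + v 1
  RelMap := fun r v => match r, v with
    | .lt, v => v 0 < v 1

/-- The structure `⟨ℤ; <, +, -, 0, 1, {≡ₙ}⟩`. -/
instance intLCong : LCong.Structure ℤ where
  funMap := fun f v => match f, v with
    | .zero, _ => 0
    | .one, _ => 1
    | .neg, v => -(v 0)
    | .add, v => v 0 + v 1
  RelMap := fun r v => match r, v with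
    | .lt, v => v 0 < v 1
    | .cong n _, v => v 0 ≡ v 1 [ZMOD n]

/-! ### Terms and formulas of `{<, +, -, 0, 1}` -/

section Terms

variable {α : Type}

/-- The term `0`. -/
def tZero : LGroup.Term α := Term.func (l := 0) GroupFunc.zero Fin.elim0

/-- The term `1`. -/
def tOne : LGroup.Term α := Term.func (l := 0) GroupFunc.one Fin.elim0

/-- The term `-t`. -/
def tNeg (t : LGroup.Term α) : LGroup.Term α := Term.func (l := 1) GroupFunc.neg ![t]

/-- The term `s + t`. -/
def tAdd (s t : LGroup.Term α) : LGroup.Term α := Term.func (l := 2) GroupFunc.add ![s, t]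

/-- The term `n ∙ t = t + ⋯ + t` (`n` times), with `0 ∙ t = 0` and `1 ∙ t = t`. -/
def tMul : ℕ → LGroup.Term α → LGroup.Term α
  | 0, _ => tZero
  | 1, t => t
  | n + 2, t => tAdd (tMul (n + 1) t) t

/-- The numeral `1 + ⋯ + 1` (`i` times). -/
def tNum (i : ℕ) : LGroup.Term α := tMul i tOne

variable {n : ℕ}

/-- The formula `s < t`. -/
def fLt (s t : LGroup.Term (α ⊕ Fin n)) : LGroup.BoundedFormula α n :=
  BoundedFormula.rel (l := 2) OrdRel.lt ![s, t]

/-- The formula `s = t`. -/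
def fEq (s t : LGroup.Term (α ⊕ Fin n)) : LGroup.BoundedFormula α n :=
  BoundedFormula.equal s t

/-- The formula `s ≤ t`, that is, `s < t ∨ s = t`. -/
def fLe (s t : LGroup.Term (α ⊕ Fin n)) : LGroup.BoundedFormula α n :=
  fLt s t ⊔ fEq s t

/-- The variable bound by the `i`-th quantifier, counted from the outside and from `0`. -/
def x (i : Fin n) : LGroup.Term (Empty ⊕ Fin n) := Term.var (Sum.inr i)

end Terms

/-! ### The axioms -/

/-- `∀ x y, x < y → ¬ y < x`. -/
def axO1 : LGroup.Sentence :=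
  BoundedFormula.all <| BoundedFormula.all (n := 1) <|
    (fLt (x 0) (x 1)).imp (fLt (x 1) (x 0)).not

/-- `∀ x y z, x < y ∧ y < z → x < z`. -/
def axO2 : LGroup.Sentence :=
  BoundedFormula.all <| BoundedFormula.all (n := 1) <| BoundedFormula.all (n := 2) <|
    (fLt (x 0) (x 1) ⊓ fLt (x 1) (x 2)).imp (fLt (x 0) (x 2))

/-- `∀ x y, x < y ∨ x = y ∨ y < x`. -/
def axO3 : LGroup.Sentence :=
  BoundedFormula.all <| BoundedFormula.all (n := 1) <|
    fLt (x 0) (x 1) ⊔ (fEq (x 0) (x 1) ⊔ fLt (x 1) (x 0))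

/-- `∀ x y z, x + (y + z) = (x + y) + z`. -/
def axA1 : LGroup.Sentence :=
  BoundedFormula.all <| BoundedFormula.all (n := 1) <| BoundedFormula.all (n := 2) <|
    fEq (tAdd (x 0) (tAdd (x 1) (x 2))) (tAdd (tAdd (x 0) (x 1)) (x 2))

/-- `∀ x, x + 0 = x`. -/
def axA2 : LGroup.Sentence :=
  BoundedFormula.all (n := 0) <| fEq (tAdd (x 0) tZero) (x 0)

/-- `∀ x, x + (-x) = 0`. -/
def axA3 : LGroup.Sentence :=
  BoundedFormula.all (n := 0) <| fEq (tAdd (x 0) (tNeg (x 0))) tZero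

/-- `∀ x y, x + y = y + x`. -/
def axA4 : LGroup.Sentence :=
  BoundedFormula.all <| BoundedFormula.all (n := 1) <|
    fEq (tAdd (x 0) (x 1)) (tAdd (x 1) (x 0))

/-- `∀ x y z, x < y → x + z < y + z`. -/
def axA5 : LGroup.Sentence :=
  BoundedFormula.all <| BoundedFormula.all (n := 1) <| BoundedFormula.all (n := 2) <|
    (fLt (x 0) (x 1)).imp (fLt (tAdd (x 0) (x 2)) (tAdd (x 1) (x 2)))

/-- Discreteness: `∀ x y, x < y ↔ x + 1 ≤ y`. -/
def axO7 : LGroup.Sentence :=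
  BoundedFormula.all <| BoundedFormula.all (n := 1) <|
    (fLt (x 0) (x 1)).iff (fLe (tAdd (x 0) tOne) (x 1))

/-- The division algorithm for `n`: `∀ x, ∃ y, ⋁_{i < n} x = n ∙ y + i`. -/
def axA7 (n : ℕ) : LGroup.Sentence :=
  BoundedFormula.all <| BoundedFormula.ex (n := 1) <|
    ((List.range n).map fun i => fEq (x 0) (tAdd (tMul n (x 1)) (tNum i))).foldr (· ⊔ ·) ⊥

/-- The theory, in `{<, +, -, 0, 1}`, of discretely ordered abelian groups with the division
algorithm. (Non-triviality is a consequence of `axO7`.) -/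
def discreteDivTheory : LGroup.Theory :=
  {axO1, axO2, axO3, axA1, axA2, axA3, axA4, axA5, axO7} ∪ {φ | ∃ n : ℕ, 1 ≤ n ∧ φ = axA7 n}

/-- The definition of `≡ₙ`: `∀ x y, x ≡ₙ y ↔ ∃ z, x + n ∙ z = y`. -/
def axCong (n : ℕ) (hn : 2 ≤ n) : LCong.Sentence :=
  BoundedFormula.all <| BoundedFormula.all (n := 1) <|
    (BoundedFormula.rel (l := 2) (CongRel.cong n hn)
        ![Term.var (Sum.inr (0 : Fin 2)), Term.var (Sum.inr (1 : Fin 2))]).iff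
      (groupToCong.onBoundedFormula
        (BoundedFormula.ex (n := 2) <| fEq (tAdd (x 0) (tMul n (x 2))) (x 1)))

/-- The expansion of `discreteDivTheory` by the definitions of the congruences. -/
def discreteDivCongTheory : LCong.Theory :=
  groupToCong.onTheory discreteDivTheory ∪
    {φ | ∃ (n : ℕ) (hn : 2 ≤ n), φ = axCong n hn}

/-! ### Quantifier elimination -/

/-- `T` admits quantifier elimination: modulo `T` every formula is equivalent to a quantifier-free
formula with (at most) the same free variables. -/
def AdmitsQE {L : FirstOrder.Language.{0, 0}} (T : L.Theory) : Prop :=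
  ∀ (k : ℕ) (φ : L.Formula (Fin k)), ∃ ψ : L.Formula (Fin k),
    BoundedFormula.IsQF ψ ∧ T ⊨ᵇ BoundedFormula.iff φ ψ

/-! ### Gödel numbers and decidability -/

/-- A numbering of the symbols of a language, injective in every arity. -/
class Numbering (L : FirstOrder.Language.{0, 0}) where
  func : ∀ {l : ℕ}, L.Functions l → ℕ
  rel : ∀ {l : ℕ}, L.Relations l → ℕ
  func_injective : ∀ l : ℕ, Function.Injective (func (l := l))
  rel_injective : ∀ l : ℕ, Function.Injective (rel (l := l))

instance : Numbering LAdd where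
  func := fun f => match f with
    | .add => 0
  rel := fun r => match r with
    | .lt => 0
  func_injective := by
    rintro l ⟨⟩ ⟨⟩ h
    rfl
  rel_injective := by
    rintro l ⟨⟩ ⟨⟩ h
    rfl

instance : Numbering LGroup where
  func := fun f => match f with
    | .zero => 0
    | .one => 1
    | .neg => 0
    | .add => 0
  rel := fun r => match r with
    | .lt => 0
  func_injective := by
    intro l f g h
    cases f <;> cases g <;> first | rfl | exact absurd h (by decide)
  rel_injective := by
    rintro l ⟨⟩ ⟨⟩ h
    rfl

instance : Numbering LCong where
  func := fun f => match f with
    | .zero => 0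
    | .one => 1
    | .neg => 0
    | .add => 0
  rel := fun r => match r with
    | .lt => 0
    | .cong n _ => n
  func_injective := by
    intro l f g h
    cases f <;> cases g <;> first | rfl | exact absurd h (by decide)
  rel_injective := by
    intro l r s h
    cases r with
    | lt =>
      cases s with
      | lt => rfl
      | cong m hm =>
        change 0 = m at h
        omega
    | cong n hn =>
      cases s with
      | lt =>
        change n = 0 at h
        omega
      | cong m hm =>
        change n = m at h
        subst h
        rfl

section Code

variable {L : FirstOrder.Language.{0, 0}} [Numbering L]

/-- The Gödel number of a term with variables `x₀, …, xₙ₋₁`. -/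
def termCode {n : ℕ} : L.Term (Empty ⊕ Fin n) → ℕ
  | .var (Sum.inr i) => Nat.pair 0 i
  | .func (l := l) f ts =>
      Nat.pair (l + 1) (Nat.pair (Numbering.func f)
        (Encodable.encode (List.ofFn fun i => termCode (ts i))))

/-- The Gödel number of a formula with free variables among `x₀, …, xₙ₋₁`. -/
def formulaCode : {n : ℕ} → L.BoundedFormula Empty n → ℕ
  | _, .falsum => Nat.pair 0 0
  | _, .equal s t => Nat.pair 1 (Nat.pair (termCode s) (termCode t))
  | _, .rel (l := l) r ts =>
      Nat.pair 2 (Nat.pair l (Nat.pair (Numbering.rel r)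
        (Encodable.encode (List.ofFn fun i => termCode (ts i)))))
  | _, .imp φ ψ => Nat.pair 3 (Nat.pair (formulaCode φ) (formulaCode ψ))
  | _, .all φ => Nat.pair 4 (formulaCode φ)

theorem termCode_injective {n : ℕ} :
    Function.Injective (termCode : L.Term (Empty ⊕ Fin n) → ℕ) := by
  intro s
  induction s with
  | var i =>
    intro t h
    rcases i with i | i
    · exact i.elim
    · cases t with
      | var j =>
        rcases j with j | j
        · exact j.elim
        · simp only [termCode, Nat.pair_eq_pair] at h
          rw [Fin.ext h.2]
      | func g us => simp [termCode, Nat.pair_eq_pair] at h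
  | @func l f ts ih =>
    intro t h
    cases t with
    | var j =>
      rcases j with j | j
      · exact j.elim
      · simp [termCode, Nat.pair_eq_pair] at h
    | @func m g us =>
      simp only [termCode, Nat.pair_eq_pair] at h
      obtain ⟨h1, h2, h3⟩ := h
      obtain rfl : l = m := by omega
      obtain rfl := Numbering.func_injective l h2
      have h4 := List.ofFn_injective (Encodable.encode_injective h3)
      have h5 : ts = us := funext fun i => ih i (congrFun h4 i)
      rw [h5]

/-- Different formulas have different Gödel numbers. -/
theorem formulaCode_injective {n : ℕ} :
    Function.Injective (formulaCode : L.BoundedFormula Empty n → ℕ) := by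
  intro φ
  induction φ with
  | falsum =>
    intro ψ h
    cases ψ <;> simp only [formulaCode, Nat.pair_eq_pair] at h <;> first | rfl | omega
  | equal s t =>
    intro ψ h
    cases ψ <;> simp only [formulaCode, Nat.pair_eq_pair] at h <;> try omega
    rw [termCode_injective h.2.1, termCode_injective h.2.2]
  | @rel n l r ts =>
    intro ψ h
    cases ψ <;> simp only [formulaCode, Nat.pair_eq_pair] at h <;> try omega
    obtain ⟨-, rfl, h2, h3⟩ := h
    obtain rfl := Numbering.rel_injective l h2
    have h4 := List.ofFn_injective (Encodable.encode_injective h3)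
    rw [funext fun i => termCode_injective (congrFun h4 i)]
  | imp a b iha ihb =>
    intro ψ h
    cases ψ <;> simp only [formulaCode, Nat.pair_eq_pair] at h <;> try omega
    rw [iha h.2.1, ihb h.2.2]
  | all a iha =>
    intro ψ h
    cases ψ <;> simp only [formulaCode, Nat.pair_eq_pair] at h <;> try omega
    rw [iha h.2]

end Code

/-- The first-order theory of the structure `M` is decidable: there is an algorithm that decides,
given the Gödel number of a sentence, whether the sentence is true in `M`. -/
def HasDecidableTheory (L : FirstOrder.Language.{0, 0}) [Numbering L] (M : Type) [L.Structure M] : Prop :=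
  ∃ p : ℕ → Prop, ComputablePred p ∧ ∀ φ : L.Sentence, p (formulaCode φ) ↔ M ⊨ φ

end IntOrdAdd

namespace IntOrdAdd

open FirstOrder.Language

/-! A single finite back-and-forth argument gives all three claims. A term is an integer linear form
in its variables plus an integer constant, so an atomic formula speaks only of the sign of such a
form or of its divisibility by some q. Two tuples, possibly in different models, `Agree` to level N
if all forms with coefficients up to N have the same sign, and the same divisibility by every q ≤ N,
at both.

The heart is `exists_witness`. Given a tuple a and an element x, put P = N!. Multiplying 0 < e·x +
L(a), where |e| ≤ N, by P/|e| turns it into a comparison of P·x with one of finitely many forms in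
a. If P·x is far above the largest of these below it, the division algorithm moves x by a multiple
of P so that P·x lands within 2P² of that form without crossing any form; if all forms lie above
P·x, reflect. Divisibility by q ≤ N is untouched because q divides P. So x may be replaced by some
x' with P·x' equal to an explicit form in a.

This has two uses. First, the equation for x' says that a form is divisible by P, which transfers to
any tuple b agreeing with a to the higher level `agreeStep N`, and the quotient there is the partner
of x (`Agree.exists_extend`). By induction on formulas, agreement to level `rank φ` makes φ equally
true (`Agree.realize_iff`). Empty tuples always agree, since the sign and divisibility of w·1 are
those of the integer w; this is completeness. Agreement to a fixed level is expressed by finitely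
many quantifier-free formulas; this is quantifier elimination.

Second, inside ℤ the element x' has size bounded by the parameters and N, so every quantifier can be
restricted to a computable finite range (`forall_realize_of_forall_le`). Truth of a sentence is then
evaluated by a primitive recursive function of its code. -/

/-- Discretely ordered abelian groups with the division algorithm. -/
class IsZGroup (M : Type*) [AddCommGroup M] [LinearOrder M] [IsOrderedAddMonoid M] [One M] :
    Prop where
  zero_lt_one : (0 : M) < 1
  one_le_of_pos : ∀ x : M, 0 < x → 1 ≤ x
  exists_div : ∀ (n : ℕ), 1 ≤ n → ∀ x : M, ∃ (y : M) (i : ℕ), i < n ∧ x = n • y + i • (1 : M)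

/-! ### Integer linear forms with a constant term -/

section LinearForm

variable {M ι : Type*} [AddCommGroup M] [One M] [Fintype ι]

/-- The value at `a` of the linear form with coefficients `c` and constant term `w`. -/
def linForm (c : ι → ℤ) (w : ℤ) (a : ι → M) : M := ∑ i, c i • a i + w • (1 : M)

theorem linForm_add (c d : ι → ℤ) (w z : ℤ) (a : ι → M) :
    linForm c w a + linForm d z a = linForm (c + d) (w + z) a := by
  simp only [linForm, Pi.add_apply, add_smul, Finset.sum_add_distrib]
  abel

theorem zsmul_linForm (k : ℤ) (c : ι → ℤ) (w : ℤ) (a : ι → M) :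
    k • linForm c w a = linForm (k • c) (k * w) a := by
  simp only [linForm, Pi.smul_apply, smul_add, Finset.smul_sum, smul_smul, smul_eq_mul]

theorem neg_linForm (c : ι → ℤ) (w : ℤ) (a : ι → M) :
    -linForm c w a = linForm (-c) (-w) a := by
  have := zsmul_linForm (-1) c w a
  simpa using this

@[simp] theorem linForm_zero_zero (a : ι → M) : linForm 0 0 a = 0 := by simp [linForm]

end LinearForm

/-! ### Moving an element close to a linear form in the parameters -/

section ZGroup

variable {M : Type*} [AddCommGroup M] [LinearOrder M] [IsOrderedAddMonoid M] [One M]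

/-- By discreteness a positive element is at least 1, so 1 can be subtracted repeatedly until 0 is
reached. -/
theorem exists_nat_smul_one_of_le [IsZGroup M] (n : ℕ) : ∀ x : M, 0 ≤ x → x ≤ n • (1 : M) →
    ∃ m : ℕ, m ≤ n ∧ x = m • (1 : M) := by
  induction n with
  | zero =>
    intro x h0 h1
    exact ⟨0, le_rfl, by simpa using le_antisymm (by simpa using h1) h0⟩
  | succ n ih =>
    intro x h0 h1
    rcases h0.eq_or_lt with rfl | h0
    · exact ⟨0, by omega, by simp⟩
    · obtain ⟨m, hm, h⟩ := ih (x - 1) (sub_nonneg.2 (IsZGroup.one_le_of_pos x h0))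
        (by rw [sub_le_iff_le_add, ← succ_nsmul]; exact h1)
      exact ⟨m + 1, by omega, by rw [succ_nsmul, ← h, sub_add_cancel]⟩

/-- If `S` contains an element below `P ∙ x`, then some `x'` congruent to `x` modulo `P` with `P ∙
x'` close to an element of `S` lies in the same position as `x` relative to `S`. -/
theorem exists_close_of_exists_le [IsZGroup M] (P : ℕ) (hP : 1 ≤ P) (S : Set M) (hS : S.Finite) (x : M)
    (h : ∃ u ∈ S, u ≤ P • x) :
    ∃ u ∈ S, ∃ (s : ℤ) (x' : M), |s| ≤ 2 * (P : ℤ) ^ 2 ∧ P • x' = u + s • (1 : M) ∧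
      (∃ y, x' = x + P • y) ∧ ∀ u ∈ S, (u < P • x ↔ u < P • x') ∧ (P • x < u ↔ P • x' < u) := by
  obtain ⟨u, ⟨huS, hu⟩, hmax⟩ := Set.exists_max_image {u ∈ S | u ≤ P • x} id
    (hS.subset (Set.sep_subset _ _)) h
  simp only [id, Set.mem_ofPred_eq, and_imp] at hmax
  have h1 := IsZGroup.zero_lt_one (M := M)
  -- Here u is the largest element of S not above P·x. If the gap is small, x itself serves;
  -- otherwise x is pulled down towards u.
  by_cases hd : P • x - u ≤ (2 * P ^ 2) • (1 : M)
  · obtain ⟨m, hm, h⟩ := exists_nat_smul_one_of_le _ _ (sub_nonneg.2 hu) hd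
    refine ⟨u, huS, m, x, ?_, ?_, ⟨0, by simp⟩, fun _ _ => ⟨Iff.rfl, Iff.rfl⟩⟩
    · rw [Nat.abs_cast]; exact_mod_cast hm
    · rw [natCast_zsmul, ← h]; abel
  · push Not at hd
    obtain ⟨y, i, hi, h⟩ := IsZGroup.exists_div (P ^ 2) (Nat.one_le_pow _ _ hP) (P • x - u)
    have hx : P • x = u + P ^ 2 • y + i • (1 : M) := by rw [add_assoc, ← h]; abel
    -- Shifting by -P·y alone would leave the remainder i, possibly 0. The extra P keeps P·x'
    -- strictly above u, and i + P² < 2P² keeps it below P·x.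
    have hx' : P • (x + P • (1 - y)) = u + (i + P ^ 2) • (1 : M) := by
      rw [smul_add, hx, smul_smul, ← pow_two, smul_sub, add_smul]; abel
    have hlow : u < P • (x + P • (1 - y)) := by
      rw [hx']
      refine lt_add_of_pos_right _ (nsmul_pos h1 (by positivity))
    have hup : P • (x + P • (1 - y)) < P • x := by
      rw [hx']
      refine lt_of_le_of_lt ?_ (lt_sub_iff_add_lt'.1 hd)
      gcongr
      omega
    have hlt : u < P • x := hlow.trans hup
    refine ⟨u, huS, (i + P ^ 2 : ℕ), x + P • (1 - y), ?_, ?_, ⟨1 - y, rfl⟩, fun v hv => ?_⟩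
    · rw [Nat.abs_cast]; push_cast
      have : (i : ℤ) < P ^ 2 := by exact_mod_cast hi
      omega
    · rw [hx', natCast_zsmul]
    · rcases le_or_gt v (P • x) with hvx | hvx
      · have := hmax v hv hvx
        exact ⟨iff_of_true (this.trans_lt hlt) (this.trans_lt hlow),
          iff_of_false hvx.not_gt (this.trans_lt hlow).not_gt⟩
      · exact ⟨iff_of_false hvx.not_gt (hup.trans hvx).not_gt,
          iff_of_true hvx (hup.trans hvx)⟩

/-- If all of S lies above P·x, then -S = S has elements below P·(-x), and the one-sided case for -x
can be reflected back. -/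
theorem exists_close [IsZGroup M] (P : ℕ) (hP : 1 ≤ P) (S : Set M) (hS : S.Finite) (hne : S.Nonempty)
    (hneg : ∀ u ∈ S, -u ∈ S) (x : M) :
    ∃ u ∈ S, ∃ (s : ℤ) (x' : M), |s| ≤ 2 * (P : ℤ) ^ 2 ∧ P • x' = u + s • (1 : M) ∧
      (∃ y, x' = x + P • y) ∧ ∀ u ∈ S, (u < P • x ↔ u < P • x') ∧ (P • x < u ↔ P • x' < u) := by
  by_cases h : ∃ u ∈ S, u ≤ P • x
  · exact exists_close_of_exists_le P hP S hS x h
  · push Not at h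
    obtain ⟨v, hv⟩ := hne
    obtain ⟨u, hu, s, x', hs, hx', ⟨y, hy⟩, H⟩ := exists_close_of_exists_le P hP S hS (-x)
      ⟨-v, hneg v hv, by rw [smul_neg]; exact neg_le_neg (h v hv).le⟩
    refine ⟨-u, hneg u hu, -s, -x', by rwa [abs_neg], ?_, ⟨-y, ?_⟩, fun v hv => ?_⟩
    · rw [smul_neg, hx', neg_smul, neg_add]
    · rw [hy, smul_neg, neg_add, neg_neg]
    · have := H (-v) (hneg v hv)
      rw [smul_neg] at this
      rw [smul_neg]
      exact ⟨neg_lt_neg_iff.symm.trans (this.2.trans lt_neg),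
        neg_lt_neg_iff.symm.trans (this.1.trans neg_lt)⟩

/-- The coefficients and the constant term of a linear form are bounded by `N`. -/
def CoeffBound {ι : Type*} (N : ℕ) (c : ι → ℤ) (w : ℤ) : Prop := (∀ i, |c i| ≤ N) ∧ |w| ≤ N

theorem CoeffBound.mono {ι : Type*} {N N' : ℕ} (h : N ≤ N') {c : ι → ℤ} {w : ℤ}
    (hc : CoeffBound N c w) : CoeffBound N' c w :=
  ⟨fun i => (hc.1 i).trans (by exact_mod_cast h), hc.2.trans (by exact_mod_cast h)⟩

theorem CoeffBound.add {ι : Type*} {N N' : ℕ} {c d : ι → ℤ} {w z : ℤ} (hc : CoeffBound N c w)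
    (hd : CoeffBound N' d z) : CoeffBound (N + N') (c + d) (w + z) := by
  push_cast [CoeffBound]
  exact ⟨fun i => (abs_add_le _ _).trans (add_le_add (hc.1 i) (hd.1 i)),
    (abs_add_le _ _).trans (add_le_add hc.2 hd.2)⟩

theorem CoeffBound.zsmul {ι : Type*} {K N : ℕ} {k : ℤ} (hk : |k| ≤ K) {c : ι → ℤ} {w : ℤ}
    (hc : CoeffBound N c w) : CoeffBound (K * N) (k • c) (k * w) := by
  push_cast [CoeffBound]
  refine ⟨fun i => ?_, ?_⟩
  · rw [Pi.smul_apply, smul_eq_mul, abs_mul]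
    exact mul_le_mul hk (hc.1 i) (abs_nonneg _) (by positivity)
  · rw [abs_mul]
    exact mul_le_mul hk hc.2 (abs_nonneg _) (by positivity)

theorem CoeffBound.neg {ι : Type*} {N : ℕ} {c : ι → ℤ} {w : ℤ}
    (hc : CoeffBound N c w) : CoeffBound N (-c) (-w) := by
  simpa [CoeffBound] using hc

theorem finite_setOf_coeffBound {ι : Type*} [Fintype ι] (N : ℕ) :
    {p : (ι → ℤ) × ℤ | CoeffBound N p.1 p.2}.Finite := by
  classical
  refine ((Set.finite_Icc (fun _ => -(N : ℤ)) (fun _ => (N : ℤ))).prod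
    (Set.finite_Icc (-(N : ℤ)) N)).subset ?_
  rintro ⟨c, w⟩ ⟨h1, h2⟩
  exact ⟨⟨fun i => (abs_le.1 (h1 i)).1, fun i => (abs_le.1 (h1 i)).2⟩, abs_le.1 h2⟩

/-- Multiplying by f = P/|e| > 0 preserves the sign and makes the coefficient of x equal to ±P, so
the condition becomes a comparison of P·x with a form whose coefficients are at most P·N. -/
theorem pos_zsmul_add_linForm_iff {ι : Type*} [Fintype ι] {P N : ℕ} (hP : 1 ≤ P)
    (hdvd : ∀ e : ℕ, 1 ≤ e → e ≤ N → e ∣ P)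
    (a : ι → M) (x x' : M)
    (H : ∀ c w, CoeffBound (P * N) c w → (linForm c w a < P • x ↔ linForm c w a < P • x') ∧
      (P • x < linForm c w a ↔ P • x' < linForm c w a))
    (e : ℤ) (he : |e| ≤ N) (c : ι → ℤ) (w : ℤ) (hc : CoeffBound N c w) :
    0 < e • x + linForm c w a ↔ 0 < e • x' + linForm c w a := by
  rcases eq_or_ne e 0 with rfl | hne
  · simp
  have heN : e.natAbs ≤ N := by
    rw [Int.abs_eq_natAbs] at he
    exact_mod_cast he
  obtain ⟨f, hf⟩ := hdvd e.natAbs (by omega) heN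
  have hf0 : 0 < f := by
    rcases Nat.eq_zero_or_pos f with rfl | h
    · omega
    · exact h
  have hfP : f ≤ P := Nat.le_of_dvd hP ⟨e.natAbs, by rw [hf, mul_comm]⟩
  have hfc := (hc.zsmul (k := f) (by rw [Nat.abs_cast])).mono (Nat.mul_le_mul_right N hfP)
  have key : ∀ z : M, 0 < e • z + linForm c w a ↔
      0 < (f * e) • z + linForm ((f : ℤ) • c) (f * w) a := fun z => by
    rw [← zsmul_linForm, ← smul_smul, ← smul_add]
    exact (smul_pos_iff_of_pos_left (by exact_mod_cast hf0)).symm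
  rw [key, key]
  rcases lt_or_gt_of_ne hne with h | h
  · have hfe : (f : ℤ) * e = -(P : ℤ) := by
      rw [hf]; push_cast; rw [abs_of_neg h]; ring
    have := (H _ _ hfc).2
    simpa [hfe, ← sub_eq_neg_add] using this
  · have hfe : (f : ℤ) * e = P := by
      rw [hf]; push_cast; rw [abs_of_pos h]; ring
    have := (H _ _ hfc.neg).1
    rw [← neg_linForm] at this
    simpa [hfe, neg_lt_iff_pos_add] using this

/-- Every element can be replaced by one that is, up to division, a small linear form in `a`. -/
theorem exists_witness [IsZGroup M] {ι : Type*} [Fintype ι] (N : ℕ) (a : ι → M) (x : M) :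
    ∃ (c : ι → ℤ) (w s : ℤ) (x' : M), CoeffBound (N.factorial * N) c w ∧
      |s| ≤ 2 * (N.factorial : ℤ) ^ 2 ∧ N.factorial • x' = linForm c w a + s • (1 : M) ∧
      ∀ (e : ℤ) (c : ι → ℤ) (w : ℤ), |e| ≤ N → CoeffBound N c w →
        (0 < e • x + linForm c w a ↔ 0 < e • x' + linForm c w a) ∧
        ∀ q : ℕ, 1 ≤ q → q ≤ N →
          ((∃ y, e • x + linForm c w a = q • y) ↔ ∃ y, e • x' + linForm c w a = q • y) := by
  obtain ⟨_, ⟨⟨c, w⟩, hc, rfl⟩, s, x', hs, hx', ⟨y, hy⟩, H⟩ := exists_close N.factorial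
    N.factorial_pos ((fun p : (ι → ℤ) × ℤ => linForm p.1 p.2 a) ''
      {p | CoeffBound (N.factorial * N) p.1 p.2}) ((finite_setOf_coeffBound _).image _)
    ⟨_, (0, 0), ⟨fun _ => by simp; positivity, by simp; positivity⟩, rfl⟩
    (by
      rintro _ ⟨⟨c, w⟩, hc, rfl⟩
      exact ⟨(-c, -w), hc.neg, (neg_linForm c w a).symm⟩) x
  refine ⟨c, w, s, x', hc, hs, hx', fun e c w he hc => ⟨?_, fun q hq hqN => ?_⟩⟩
  · exact pos_zsmul_add_linForm_iff N.factorial_pos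
      (fun e h1 h2 => Nat.dvd_factorial h1 h2) a x x'
      (fun c w hc => H _ ⟨(c, w), hc, rfl⟩) e he c w hc
  · obtain ⟨f, hf⟩ := Nat.dvd_factorial hq hqN
    -- Since x' - x is a multiple of P and q divides P, the two values differ by a multiple of q.
    have hxx : e • x' + linForm c w a = e • x + linForm c w a + q • ((e * f) • y) := by
      rw [hy, hf, smul_add, ← natCast_zsmul y, ← natCast_zsmul _ q, smul_smul, smul_smul]
      push_cast
      rw [mul_left_comm]
      abel
    rw [hxx]
    constructor
    · rintro ⟨z, hz⟩
      exact ⟨z + (e * f) • y, by rw [hz, smul_add]⟩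
    · rintro ⟨z, hz⟩
      exact ⟨z - (e * f) • y, by rw [smul_sub, ← hz, add_sub_cancel_right]⟩

end ZGroup

/-! ### Agreement of tuples and the back-and-forth step -/

section Agree

variable {M M' : Type*}
  [AddCommGroup M] [LinearOrder M] [One M] [AddCommGroup M'] [LinearOrder M'] [One M']
  {ι : Type*} [Fintype ι]

/-- The linear forms with coefficients up to `N` have the same sign, and the same divisibility by
numbers up to `N`, at `a` and at `b`. -/
def Agree (N : ℕ) (a : ι → M) (b : ι → M') : Prop :=
  ∀ (c : ι → ℤ) (w : ℤ), CoeffBound N c w →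
    (0 < linForm c w a ↔ 0 < linForm c w b) ∧
    ∀ q : ℕ, 1 ≤ q → q ≤ N → ((∃ y, linForm c w a = q • y) ↔ ∃ y, linForm c w b = q • y)

theorem Agree.symm {N : ℕ} {a : ι → M} {b : ι → M'} (h : Agree N a b) : Agree N b a :=
  fun c w hc => ⟨(h c w hc).1.symm, fun q h1 h2 => ((h c w hc).2 q h1 h2).symm⟩

theorem Agree.mono {N N' : ℕ} (hN : N ≤ N') {a : ι → M} {b : ι → M'} (h : Agree N' a b) :
    Agree N a b :=
  fun c w hc => ⟨(h c w (hc.mono hN)).1, fun q h1 h2 => (h c w (hc.mono hN)).2 q h1 (h2.trans hN)⟩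

/-- The amount of agreement needed to add one element with agreement `N`. -/
def agreeStep (N : ℕ) : ℕ :=
  -- With P = N!, the first two summands bound the forms e·c₀ + P·c tested after substituting the
  -- witness, the third bounds the form equal to P·x', and the last admits P as a modulus.
  N * (N.factorial * N + 2 * N.factorial ^ 2) + N.factorial * N +
    (N.factorial * N + 2 * N.factorial ^ 2) + N.factorial

theorem le_agreeStep (N : ℕ) : N ≤ agreeStep N := by
  have := Nat.le_mul_of_pos_left N N.factorial_pos
  unfold agreeStep
  omega

theorem zsmul_linForm_nsmul {M : Type*} [AddCommGroup M] [One M] {P : ℕ} {x : M} {a : ι → M}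
    {c₀ : ι → ℤ} {w₀ : ℤ} (hx : P • x = linForm c₀ w₀ a) (e : ℤ) (c : ι → ℤ) (w : ℤ) :
    P • (e • x + linForm c w a) = linForm (e • c₀ + (P : ℤ) • c) (e * w₀ + P * w) a := by
  rw [← linForm_add, ← zsmul_linForm, ← zsmul_linForm, ← hx, smul_add, smul_comm, natCast_zsmul]

/-- An ordered group is torsion-free, so the factor P can be cancelled. -/
theorem exists_eq_nsmul_iff {M : Type*} [AddCommGroup M] [LinearOrder M] [IsOrderedAddMonoid M]
    {P : ℕ} (hP : 1 ≤ P) (q : ℕ) (t : M) :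
    (∃ y, t = q • y) ↔ ∃ y, P • t = (P * q) • y := by
  constructor
  · rintro ⟨y, rfl⟩
    exact ⟨y, by rw [mul_smul]⟩
  · rintro ⟨y, hy⟩
    refine ⟨y, ?_⟩
    rw [mul_smul] at hy
    exact nsmul_right_injective (by omega) hy

/-- The extension step of the back-and-forth argument. -/
theorem Agree.exists_extend [IsOrderedAddMonoid M] [IsOrderedAddMonoid M'] [IsZGroup M]
    {N : ℕ} {a : ι → M} {b : ι → M'}
    (h : Agree (agreeStep N) a b) (x : M) :
    ∃ y : M', ∀ (e : ℤ) (c : ι → ℤ) (w : ℤ), |e| ≤ N → CoeffBound N c w →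
        (0 < e • x + linForm c w a ↔ 0 < e • y + linForm c w b) ∧
        ∀ q : ℕ, 1 ≤ q → q ≤ N →
          ((∃ z, e • x + linForm c w a = q • z) ↔ ∃ z, e • y + linForm c w b = q • z) := by
  obtain ⟨c₀, w₀, s, x', hc₀, hs, hx', H⟩ := exists_witness N a x
  have hP := N.factorial_pos
  set P := N.factorial with hPdef
  have hx'' : P • x' = linForm c₀ (w₀ + s) a := by
    rw [hx']
    have := linForm_add c₀ 0 w₀ s a
    rw [add_zero] at this
    rw [← this]
    simp [linForm]
  have hb : CoeffBound (P * N + 2 * P ^ 2) c₀ (w₀ + s) := by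
    have := hc₀.add (d := 0) (z := s) (N' := 2 * P ^ 2) ⟨by simp, by exact_mod_cast hs⟩
    rwa [add_zero] at this
  have hle : P * N + 2 * P ^ 2 ≤ agreeStep N := by unfold agreeStep; rw [← hPdef]; omega
  have hle2 : P ≤ agreeStep N := by unfold agreeStep; rw [← hPdef]; omega
  -- The form equal to P·x' is divisible by P at a, hence at b; the partner of x is the quotient at
  -- b.
  obtain ⟨y, hy⟩ := ((h _ _ (hb.mono hle)).2 P hP hle2).1 ⟨x', hx''.symm⟩
  refine ⟨y, fun e c w he hc => ?_⟩
  have hcb : CoeffBound (agreeStep N) (e • c₀ + (P : ℤ) • c) (e * (w₀ + s) + P * w) :=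
    ((hb.zsmul he).add (hc.zsmul (k := P) (by rw [Nat.abs_cast]))).mono (by
      unfold agreeStep; rw [← hPdef]; omega)
  obtain ⟨h1, h2⟩ := h _ _ hcb
  rw [← zsmul_linForm_nsmul hx'', ← zsmul_linForm_nsmul hy.symm] at h1 h2
  refine ⟨(H e c w he hc).1.trans ?_, fun q hq hqN => ((H e c w he hc).2 q hq hqN).trans ?_⟩
  · rwa [smul_pos_iff_of_pos_left hP, smul_pos_iff_of_pos_left hP] at h1
  · rw [exists_eq_nsmul_iff hP, exists_eq_nsmul_iff hP (t := e • y + _)]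
    refine h2 (P * q) (Nat.mul_pos hP hq) ?_
    have : P * q ≤ P * N := Nat.mul_le_mul_left P hqN
    unfold agreeStep; rw [← hPdef]; omega

theorem linForm_snoc {M α : Type*} [AddCommGroup M] [One M] [Fintype α] {n : ℕ} (v : α → M)
    (xs : Fin n → M) (x : M) (c : α ⊕ Fin (n + 1) → ℤ) (w : ℤ) :
    linForm c w (Sum.elim v (Fin.snoc xs x : Fin (n + 1) → M)) =
      c (Sum.inr (Fin.last n)) • x +
        linForm (fun i => c (Sum.map id Fin.castSucc i)) w (Sum.elim v xs) := by
  simp [linForm, Fintype.sum_sum_type, Fin.sum_univ_castSucc]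
  abel

/-- Two tuples extended by one element each agree if the extensions satisfy the same conditions. -/
theorem agree_snoc {α : Type*} [Fintype α] {n N : ℕ} {v : α → M} {xs : Fin n → M}
    {v' : α → M'} {xs' : Fin n → M'} {x : M} {y : M'}
    (h : ∀ (e : ℤ) (c : α ⊕ Fin n → ℤ) (w : ℤ), |e| ≤ N → CoeffBound N c w →
        (0 < e • x + linForm c w (Sum.elim v xs) ↔ 0 < e • y + linForm c w (Sum.elim v' xs')) ∧
        ∀ q : ℕ, 1 ≤ q → q ≤ N → ((∃ z, e • x + linForm c w (Sum.elim v xs) = q • z) ↔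
          ∃ z, e • y + linForm c w (Sum.elim v' xs') = q • z)) :
    Agree N (Sum.elim v (Fin.snoc xs x : Fin (n + 1) → M))
      (Sum.elim v' (Fin.snoc xs' y : Fin (n + 1) → M')) := by
  intro c w hc
  have := h (c (Sum.inr (Fin.last n))) (fun i => c (Sum.map id Fin.castSucc i)) w (hc.1 _)
    ⟨fun i => hc.1 _, hc.2⟩
  rw [linForm_snoc, linForm_snoc]
  exact this

theorem Agree.exists_snoc [IsOrderedAddMonoid M] [IsOrderedAddMonoid M'] [IsZGroup M]
    {α : Type*} [Fintype α] {n N : ℕ} {v : α → M}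
    {xs : Fin n → M} {v' : α → M'} {xs' : Fin n → M'}
    (h : Agree (agreeStep N) (Sum.elim v xs) (Sum.elim v' xs')) (x : M) :
    ∃ y : M', Agree N (Sum.elim v (Fin.snoc xs x : Fin (n + 1) → M))
      (Sum.elim v' (Fin.snoc xs' y : Fin (n + 1) → M')) := by
  obtain ⟨y, hy⟩ := h.exists_extend x
  exact ⟨y, agree_snoc hy⟩

end Agree

/-! ### Standard models and the values of terms -/

instance : IsZGroup ℤ where
  zero_lt_one := Int.zero_lt_one
  one_le_of_pos := fun _ h => h
  exists_div := fun n hn x => ⟨x / n, (x % n).toNat, by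
    have h1 := Int.emod_nonneg x (b := n) (by omega)
    have h2 := Int.emod_lt_of_pos x (b := n) (by omega)
    have h3 := Int.mul_ediv_add_emod x n
    constructor
    · omega
    · rw [nsmul_eq_mul, nsmul_eq_mul, Int.toNat_of_nonneg h1, mul_one, h3]⟩

/-- Structures for the language with congruences whose symbols have the standard meaning in a
discretely ordered abelian group with the division algorithm. -/
class IsCongModel (M : Type*) [LCong.Structure M] [AddCommGroup M] [LinearOrder M]
    [IsOrderedAddMonoid M] [One M] : Prop extends IsZGroup M where
  funMap_zero : ∀ v, Structure.funMap (L := LCong) (M := M) (n := 0) GroupFunc.zero v = 0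
  funMap_one : ∀ v, Structure.funMap (L := LCong) (M := M) (n := 0) GroupFunc.one v = 1
  funMap_neg : ∀ v, Structure.funMap (L := LCong) (M := M) (n := 1) GroupFunc.neg v = -v 0
  funMap_add : ∀ v, Structure.funMap (L := LCong) (M := M) (n := 2) GroupFunc.add v = v 0 + v 1
  relMap_lt : ∀ v, Structure.RelMap (L := LCong) (M := M) (n := 2) CongRel.lt v ↔ v 0 < v 1
  relMap_cong : ∀ n hn v, Structure.RelMap (L := LCong) (M := M) (n := 2) (CongRel.cong n hn) v ↔
    ∃ z, v 0 + n • z = v 1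

instance : IsCongModel ℤ where
  funMap_zero _ := rfl
  funMap_one _ := rfl
  funMap_neg _ := rfl
  funMap_add _ := rfl
  relMap_lt _ := Iff.rfl
  relMap_cong n hn v := by
    change v 0 ≡ v 1 [ZMOD n] ↔ _
    rw [Int.modEq_iff_dvd]
    constructor
    · rintro ⟨z, hz⟩
      exact ⟨z, by rw [nsmul_eq_mul, ← hz]; abel⟩
    · rintro ⟨z, hz⟩
      exact ⟨z, by rw [← hz, nsmul_eq_mul]; abel⟩

/-- The number of nodes of a term. -/
def termSize {L : FirstOrder.Language.{0, 0}} {β : Type} : L.Term β → ℕ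
  | .var _ => 1
  | .func _ ts => 1 + ∑ i, termSize (ts i)

/-- The form is chosen before the model, so one form computes the term on both sides of a comparison
between models. -/
theorem exists_linForm_eq_realize {β : Type} [Fintype β] (t : LCong.Term β) :
    ∃ (c : β → ℤ) (w : ℤ), CoeffBound (termSize t) c w ∧
      ∀ (M : Type) [LCong.Structure M] [AddCommGroup M] [LinearOrder M] [IsOrderedAddMonoid M]
        [One M] [IsCongModel M] (v : β → M), t.realize v = linForm c w v := by
  classical
  induction t with
  | var i =>
    refine ⟨Pi.single i 1, 0, ⟨fun j => ?_, by simp [termSize]⟩, ?_⟩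
    · by_cases h : j = i
      · subst h; simp [termSize]
      · simp [h, termSize]
    · intros
      simp [linForm, Pi.single_apply, ite_smul]
  | @func l f ts ih =>
    choose c w hb hr using ih
    change GroupFunc l at f
    cases f with
    | zero =>
      refine ⟨0, 0, ⟨by simp, by simp⟩, ?_⟩
      intro M _ _ _ _ _ _ v
      rw [linForm_zero_zero]
      exact IsCongModel.funMap_zero _
    | one =>
      refine ⟨0, 1, ⟨by simp, by simp [termSize]⟩, ?_⟩
      intro M _ _ _ _ _ _ v
      refine (IsCongModel.funMap_one _).trans ?_
      simp [linForm]
    | neg =>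
      refine ⟨-c 0, -w 0, (hb 0).neg.mono ?_, ?_⟩
      · simp [termSize]
      · intro M _ _ _ _ _ _ v
        refine (IsCongModel.funMap_neg _).trans ?_
        rw [hr, neg_linForm]
    | add =>
      refine ⟨c 0 + c 1, w 0 + w 1, ((hb 0).add (hb 1)).mono ?_, ?_⟩
      · simp [termSize, Fin.sum_univ_two]
      · intro M _ _ _ _ _ _ v
        refine (IsCongModel.funMap_add _).trans ?_
        rw [hr, hr, linForm_add]

/-- The agreement that guarantees that two tuples satisfy the same formula. -/
def rank {L : FirstOrder.Language.{0, 0}} [Numbering L] {α : Type} :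
    {n : ℕ} → L.BoundedFormula α n → ℕ
  | _, .falsum => 0
  | _, .equal s t => termSize s + termSize t
  | _, .rel r ts => ∑ i, termSize (ts i) + Numbering.rel r
  | _, .imp φ ψ => max (rank φ) (rank ψ)
  | _, .all φ => agreeStep (rank φ)

/-! ### Agreeing tuples satisfy the same formulas -/

section Invariance

variable {M M' : Type}
  [LCong.Structure M] [AddCommGroup M] [LinearOrder M] [IsOrderedAddMonoid M] [One M]
  [IsCongModel M]
  [LCong.Structure M'] [AddCommGroup M'] [LinearOrder M'] [IsOrderedAddMonoid M'] [One M']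
  [IsCongModel M']

theorem Agree.realize_sub {β : Type} [Fintype β] {N : ℕ} {a : β → M} {b : β → M'}
    (h : Agree N a b) (s t : LCong.Term β) (hst : termSize s + termSize t ≤ N) :
    (0 < s.realize a - t.realize a ↔ 0 < s.realize b - t.realize b) ∧
    ∀ q : ℕ, 1 ≤ q → q ≤ N → ((∃ y, s.realize a - t.realize a = q • y) ↔
      ∃ y, s.realize b - t.realize b = q • y) := by
  obtain ⟨c, w, hc, hs⟩ := exists_linForm_eq_realize s
  obtain ⟨d, z, hd, ht⟩ := exists_linForm_eq_realize t
  have := h _ _ ((hc.add hd.neg).mono hst)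
  rw [← linForm_add, ← linForm_add, ← neg_linForm, ← neg_linForm, ← hs, ← hs, ← ht, ← ht,
    ← sub_eq_add_neg, ← sub_eq_add_neg] at this
  exact this

theorem Agree.realize_lt {β : Type} [Fintype β] {N : ℕ} {a : β → M} {b : β → M'}
    (h : Agree N a b) (s t : LCong.Term β) (hst : termSize s + termSize t ≤ N) :
    s.realize a < t.realize a ↔ s.realize b < t.realize b := by
  have := (h.realize_sub t s (by omega)).1
  rwa [sub_pos, sub_pos] at this

/-- Induction on the formula, with a quantifier handled by one back-and-forth step in each
direction. The models are quantified inside the induction so that the hypothesis can be used with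
their roles exchanged. -/
theorem Agree.realize_iff {α : Type} [Fintype α] {n : ℕ} (φ : LCong.BoundedFormula α n) :
    ∀ {M M' : Type}
      [LCong.Structure M] [AddCommGroup M] [LinearOrder M] [IsOrderedAddMonoid M] [One M]
      [IsCongModel M]
      [LCong.Structure M'] [AddCommGroup M'] [LinearOrder M'] [IsOrderedAddMonoid M'] [One M']
      [IsCongModel M'] {N : ℕ} {v : α → M} {xs : Fin n → M} {v' : α → M'} {xs' : Fin n → M'},
      rank φ ≤ N → Agree N (Sum.elim v xs) (Sum.elim v' xs') →
        (φ.Realize v xs ↔ φ.Realize v' xs') := by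
  induction φ with
  | falsum => intros; exact Iff.rfl
  | equal s t =>
    intro M M' _ _ _ _ _ _ _ _ _ _ _ _ N v xs v' xs' hN h
    have h1 := h.realize_lt s t hN
    have h2 := h.realize_lt t s (by simp only [rank] at hN; omega)
    simp only [BoundedFormula.Realize]
    -- In a linear order equality is the failure of both strict inequalities, so signs of forms
    -- suffice.
    rw [eq_iff_le_not_lt, eq_iff_le_not_lt, ← not_lt, ← not_lt, h1, h2]
  | @rel n l r ts =>
    intro M M' _ _ _ _ _ _ _ _ _ _ _ _ N v xs v' xs' hN h
    change CongRel l at r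
    cases r with
    | lt =>
      refine (IsCongModel.relMap_lt _).trans (Iff.trans ?_ (IsCongModel.relMap_lt _).symm)
      refine h.realize_lt (ts 0) (ts 1) (le_trans ?_ hN)
      simp [rank, Fin.sum_univ_two]
    | cong q hq =>
      refine (IsCongModel.relMap_cong _ _ _).trans
        (Iff.trans ?_ (IsCongModel.relMap_cong _ _ _).symm)
      have hq1 : q ≤ N := le_trans (Nat.le_add_left _ _) hN
      have := (h.realize_sub (ts 1) (ts 0) (le_trans (by
        simp [rank, Fin.sum_univ_two]; omega) hN)).2 q (by omega) hq1
      simpa only [sub_eq_iff_eq_add', eq_comm (b := _ + _)] using this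
  | imp φ ψ ih1 ih2 =>
    intro M M' _ _ _ _ _ _ _ _ _ _ _ _ N v xs v' xs' hN h
    simp only [rank, max_le_iff] at hN
    rw [BoundedFormula.realize_imp, BoundedFormula.realize_imp, ih1 hN.1 h, ih2 hN.2 h]
  | all φ ih =>
    intro M M' _ _ _ _ _ _ _ _ _ _ _ _ N v xs v' xs' hN h
    have h' := h.mono hN
    rw [BoundedFormula.realize_all, BoundedFormula.realize_all]
    constructor
    · intro H y
      obtain ⟨x, hx⟩ := h'.symm.exists_snoc y
      exact (ih le_rfl hx).2 (H x)
    · intro H y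
      obtain ⟨x, hx⟩ := h'.exists_snoc y
      exact (ih le_rfl hx).2 (H x)

end Invariance

/-! ### Models of the theory -/

section Snoc

variable {M : Type*}

theorem snoc_one (u : Fin 0 → M) (a : M) : (Fin.snoc u a : Fin 1 → M) 0 = a := rfl

theorem snoc_two (u : Fin 0 → M) (a b : M) :
    (Fin.snoc (Fin.snoc u a : Fin 1 → M) b : Fin 2 → M) = ![a, b] :=
  funext (Fin.forall_fin_two.2 ⟨rfl, rfl⟩)

theorem snoc_three (a b c : M) : (Fin.snoc ![a, b] c : Fin 3 → M) = ![a, b, c] := by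
  funext i
  fin_cases i <;> rfl

end Snoc

section Operations

variable {M : Type*} [LGroup.Structure M]

/-- The interpretation of `0`. -/
def opZero (M : Type*) [LGroup.Structure M] : M :=
  Structure.funMap (L := LGroup) (n := 0) GroupFunc.zero Fin.elim0

/-- The interpretation of `1`. -/
def opOne (M : Type*) [LGroup.Structure M] : M :=
  Structure.funMap (L := LGroup) (n := 0) GroupFunc.one Fin.elim0

/-- The interpretation of `-`. -/
def opNeg (a : M) : M := Structure.funMap (L := LGroup) (n := 1) GroupFunc.neg ![a]

/-- The interpretation of `+`. -/
def opAdd (a b : M) : M := Structure.funMap (L := LGroup) (n := 2) GroupFunc.add ![a, b]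

/-- The interpretation of `<`. -/
def opLt (a b : M) : Prop := Structure.RelMap (L := LGroup) (n := 2) OrdRel.lt ![a, b]

/-- The sum of `n` copies of an element, bracketed like `tMul`. -/
def opMul : ℕ → M → M
  | 0, _ => opZero M
  | 1, a => a
  | n + 2, a => opAdd (opMul (n + 1) a) a

theorem funMap_zero_eq (v : Fin 0 → M) :
    Structure.funMap (L := LGroup) (n := 0) GroupFunc.zero v = opZero M :=
  congrArg _ (Subsingleton.elim _ _)

theorem funMap_one_eq (v : Fin 0 → M) :
    Structure.funMap (L := LGroup) (n := 0) GroupFunc.one v = opOne M :=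
  congrArg _ (Subsingleton.elim _ _)

theorem funMap_neg_eq (v : Fin 1 → M) :
    Structure.funMap (L := LGroup) (n := 1) GroupFunc.neg v = opNeg (v 0) :=
  congrArg _ (funext fun i => by rw [Subsingleton.elim i 0]; rfl)

theorem funMap_add_eq (v : Fin 2 → M) :
    Structure.funMap (L := LGroup) (n := 2) GroupFunc.add v = opAdd (v 0) (v 1) :=
  congrArg _ (funext (Fin.forall_fin_two.2 ⟨rfl, rfl⟩))

theorem relMap_lt_eq (v : Fin 2 → M) :
    Structure.RelMap (L := LGroup) (n := 2) OrdRel.lt v = opLt (v 0) (v 1) :=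
  congrArg _ (funext (Fin.forall_fin_two.2 ⟨rfl, rfl⟩))

variable {α : Type} (v : α → M)

theorem realize_tZero : (tZero : LGroup.Term α).realize v = opZero M := funMap_zero_eq _

theorem realize_tOne : (tOne : LGroup.Term α).realize v = opOne M := funMap_one_eq _

theorem realize_tNeg (t : LGroup.Term α) : (tNeg t).realize v = opNeg (t.realize v) :=
  funMap_neg_eq _

theorem realize_tAdd (s t : LGroup.Term α) :
    (tAdd s t).realize v = opAdd (s.realize v) (t.realize v) :=
  funMap_add_eq _

theorem realize_tMul (t : LGroup.Term α) : ∀ n, (tMul n t).realize v = opMul n (t.realize v)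
  | 0 => realize_tZero v
  | 1 => rfl
  | n + 2 => by rw [tMul, realize_tAdd, realize_tMul t (n + 1), opMul]

theorem realize_tNum (n : ℕ) : (tNum n : LGroup.Term α).realize v = opMul n (opOne M) := by
  rw [tNum, realize_tMul, realize_tOne]

theorem realize_fLt {n : ℕ} (xs : Fin n → M) (s t : LGroup.Term (α ⊕ Fin n)) :
    (fLt s t).Realize v xs ↔ opLt (s.realize (Sum.elim v xs)) (t.realize (Sum.elim v xs)) :=
  iff_of_eq (relMap_lt_eq _)

theorem realize_fEq {n : ℕ} (xs : Fin n → M) (s t : LGroup.Term (α ⊕ Fin n)) :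
    (fEq s t).Realize v xs ↔ s.realize (Sum.elim v xs) = t.realize (Sum.elim v xs) :=
  Iff.rfl

theorem realize_fLe {n : ℕ} (xs : Fin n → M) (s t : LGroup.Term (α ⊕ Fin n)) :
    (fLe s t).Realize v xs ↔ opLt (s.realize (Sum.elim v xs)) (t.realize (Sum.elim v xs)) ∨
      s.realize (Sum.elim v xs) = t.realize (Sum.elim v xs) := by
  rw [fLe, BoundedFormula.realize_sup, realize_fLt, realize_fEq]

theorem realize_x {n : ℕ} (u : Empty → M) (xs : Fin n → M) (i : Fin n) :
    (x i).realize (Sum.elim u xs) = xs i := rfl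

/-- The axioms spelled out in terms of the interpretations of the symbols. -/
theorem model_discreteDivTheory_iff : M ⊨ discreteDivTheory ↔
    (∀ a b : M, opLt a b → ¬ opLt b a) ∧
    (∀ a b c : M, opLt a b ∧ opLt b c → opLt a c) ∧
    (∀ a b : M, opLt a b ∨ a = b ∨ opLt b a) ∧
    (∀ a b c : M, opAdd a (opAdd b c) = opAdd (opAdd a b) c) ∧
    (∀ a : M, opAdd a (opZero M) = a) ∧
    (∀ a : M, opAdd a (opNeg a) = opZero M) ∧
    (∀ a b : M, opAdd a b = opAdd b a) ∧
    (∀ a b c : M, opLt a b → opLt (opAdd a c) (opAdd b c)) ∧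
    (∀ a b : M, opLt a b ↔ opLt (opAdd a (opOne M)) b ∨ opAdd a (opOne M) = b) ∧
    ∀ n : ℕ, 1 ≤ n → ∀ a : M, ∃ (b : M) (i : ℕ), i < n ∧
      a = opAdd (opMul n b) (opMul i (opOne M)) := by
  have h7 : (∀ φ ∈ {φ | ∃ n : ℕ, 1 ≤ n ∧ φ = axA7 n}, M ⊨ φ) ↔ ∀ n : ℕ, 1 ≤ n → M ⊨ axA7 n :=
    ⟨fun h n hn => h _ ⟨n, hn, rfl⟩, by rintro h _ ⟨n, hn, rfl⟩; exact h n hn⟩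
  rw [Theory.model_iff, discreteDivTheory]
  simp only [Set.mem_union, or_imp, forall_and, h7]
  simp only [Set.mem_insert_iff, Set.mem_singleton_iff, forall_eq_or_imp, forall_eq, and_assoc]
  simp only [axO1, axO2, axO3, axA1, axA2, axA3, axA4, axA5, axO7, axA7, Sentence.Realize,
    Formula.Realize, BoundedFormula.realize_all, BoundedFormula.realize_ex,
    BoundedFormula.realize_imp, BoundedFormula.realize_not, BoundedFormula.realize_iff,
    BoundedFormula.realize_inf, BoundedFormula.realize_sup, BoundedFormula.realize_foldr_sup,
    List.mem_map, List.mem_range, exists_exists_and_eq_and,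
    realize_fLt, realize_fLe, realize_fEq, realize_tAdd, realize_tNeg, realize_tZero, realize_tOne,
    realize_tMul, realize_tNum, realize_x, snoc_one, snoc_two, snoc_three, Matrix.cons_val_zero,
    Matrix.cons_val_one, Matrix.cons_val]

end Operations

/-- Every model of the axioms is a discretely ordered abelian group with the division algorithm. -/
theorem exists_isZGroup_of_model (M : Type) [LGroup.Structure M] (hM : M ⊨ discreteDivTheory) :
    ∃ (_ : AddCommGroup M) (_ : LinearOrder M) (_ : IsOrderedAddMonoid M) (_ : One M),
      IsZGroup M ∧ opZero M = 0 ∧ opOne M = 1 ∧ (∀ a : M, opNeg a = -a) ∧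
      (∀ a b : M, opAdd a b = a + b) ∧ (∀ (n : ℕ) (a : M), opMul n a = n • a) ∧
      ∀ a b : M, opLt a b ↔ a < b := by
  classical
  obtain ⟨o1, o2, o3, a1, a2, a3, a4, a5, o7, a7⟩ := model_discreteDivTheory_iff.1 hM
  let _ : Zero M := ⟨opZero M⟩
  let _ : Add M := ⟨opAdd⟩
  let _ : Neg M := ⟨opNeg⟩
  let gp : AddCommGroup M :=
    { add_assoc := fun a b c => (a1 a b c).symm
      zero_add := fun a => (a4 _ _).trans (a2 a)
      add_zero := a2
      nsmul := nsmulRec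
      zsmul := zsmulRec
      neg_add_cancel := fun a => (a4 _ _).trans (a3 a)
      add_comm := a4 }
  let lo : LinearOrder M :=
    { le := fun a b => opLt a b ∨ a = b
      lt := opLt
      le_refl := fun a => Or.inr rfl
      le_trans := by
        rintro a b c (h | rfl) (h' | rfl)
        · exact Or.inl (o2 _ _ _ ⟨h, h'⟩)
        · exact Or.inl h
        · exact Or.inl h'
        · exact Or.inr rfl
      lt_iff_le_not_ge := by
        intro a b
        constructor
        · intro h
          refine ⟨Or.inl h, ?_⟩
          rintro (h' | rfl)
          · exact o1 _ _ h h'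
          · exact o1 _ _ h h
        · rintro ⟨h | rfl, h'⟩
          · exact h
          · exact absurd (Or.inr rfl) h'
      le_antisymm := by
        rintro a b (h | rfl) (h' | h')
        · exact absurd h' (o1 _ _ h)
        · exact h'.symm
        · rfl
        · rfl
      le_total := by
        intro a b
        rcases o3 a b with h | h | h
        · exact Or.inl (Or.inl h)
        · exact Or.inl (Or.inr h)
        · exact Or.inr (Or.inl h)
      toDecidableLE := Classical.decRel _ }
  have om : IsOrderedAddMonoid M :=
    { add_le_add_left := by
        rintro a b (h | rfl) c
        · exact Or.inl (a5 a b c h)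
        · exact le_rfl }
  let one : One M := ⟨opOne M⟩
  have hmul : ∀ (n : ℕ) (a : M), opMul n a = n • a := by
    intro n a
    induction n using Nat.strong_induction_on with
    | _ n ih =>
      match n with
      | 0 => exact (zero_smul ℕ a).symm
      | 1 => exact (one_smul ℕ a).symm
      | n + 2 => rw [opMul, ih (n + 1) (by omega), succ_nsmul a (n + 1)]; rfl
  refine ⟨gp, lo, om, one, ⟨?_, ?_, ?_⟩, rfl, rfl, fun _ => rfl, fun _ _ => rfl, hmul,
    fun _ _ => Iff.rfl⟩
  -- Discreteness at 0 and 1 already yields 0 < 1, hence non-triviality.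
  · exact (o7 0 1).2 (Or.inr (zero_add (1 : M)))
  · intro a h
    have h' : (0 : M) + 1 ≤ a := (o7 0 a).1 h
    rwa [zero_add] at h'
  · intro n hn a
    obtain ⟨b, i, hi, h⟩ := a7 n hn a
    refine ⟨b, i, hi, ?_⟩
    rw [← hmul, ← hmul]
    exact h

theorem opMul_int (n : ℕ) (a : ℤ) : opMul n a = n * a := by
  induction n using Nat.strong_induction_on with
  | _ n ih =>
    match n with
    | 0 => rw [Nat.cast_zero, zero_mul]; rfl
    | 1 => rw [Nat.cast_one, one_mul]; rfl
    | n + 2 =>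
      rw [opMul, ih (n + 1) (by omega)]
      change ((n + 1 : ℕ) : ℤ) * a + a = _
      push_cast
      ring

instance int_model_discreteDivTheory : ℤ ⊨ discreteDivTheory := by
  have hadd : ∀ a b : ℤ, opAdd a b = a + b := fun _ _ => rfl
  have hlt : ∀ a b : ℤ, opLt a b ↔ a < b := fun _ _ => Iff.rfl
  have hneg : ∀ a : ℤ, opNeg a = -a := fun _ => rfl
  have h0 : opZero ℤ = 0 := rfl
  have h1 : opOne ℤ = 1 := rfl
  rw [model_discreteDivTheory_iff]
  simp only [hadd, hlt, hneg, h0, h1, opMul_int]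
  refine ⟨by omega, by omega, by omega, by omega, by omega, by omega, by omega, by omega,
    by omega, fun n hn a => ?_⟩
  obtain ⟨b, i, hi, h⟩ := IsZGroup.exists_div n hn a
  exact ⟨b, i, hi, by simpa using h⟩

instance addToGroup_isExpansionOn_int : addToGroup.IsExpansionOn ℤ where
  map_onFunction f _ := by cases f; rfl
  map_onRelation R _ := by cases R; rfl

instance groupToCong_isExpansionOn_int : groupToCong.IsExpansionOn ℤ where
  map_onFunction f _ := by cases f <;> rfl
  map_onRelation R _ := by cases R; rfl

section Expansion

variable {M : Type} [LCong.Structure M]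

theorem realize_axCong [LGroup.Structure M] [groupToCong.IsExpansionOn M] (n : ℕ) (hn : 2 ≤ n) :
    M ⊨ axCong n hn ↔ ∀ a b : M,
      (Structure.RelMap (L := LCong) (M := M) (n := 2) (CongRel.cong n hn) ![a, b] ↔
        ∃ c, opAdd a (opMul n c) = b) := by
  have h : ∀ (u : Empty → M) (a b : M), (BoundedFormula.rel (L := LCong) (l := 2)
      (CongRel.cong n hn) ![Term.var (Sum.inr (0 : Fin 2)), Term.var (Sum.inr (1 : Fin 2))]).Realize
        u ![a, b] ↔ Structure.RelMap (L := LCong) (M := M) (n := 2) (CongRel.cong n hn) ![a, b] :=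
    fun u a b => iff_of_eq (congrArg (Structure.RelMap (L := LCong) (M := M) (n := 2) (CongRel.cong n hn))
      (funext (Fin.forall_fin_two.2 ⟨rfl, rfl⟩)))
  simp only [axCong, Sentence.Realize, Formula.Realize, BoundedFormula.realize_all,
    BoundedFormula.realize_iff, LHom.realize_onBoundedFormula, BoundedFormula.realize_ex,
    realize_fEq, realize_tAdd, realize_tMul, realize_x, snoc_two, snoc_three, h,
    Matrix.cons_val_zero, Matrix.cons_val_one, Matrix.cons_val]

instance int_model_discreteDivCongTheory : ℤ ⊨ discreteDivCongTheory := by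
  rw [discreteDivCongTheory, Theory.model_union_iff, LHom.onTheory_model]
  refine ⟨inferInstance, ?_⟩
  rw [Theory.model_iff]
  rintro _ ⟨n, hn, rfl⟩
  rw [realize_axCong]
  intro a b
  refine (IsCongModel.relMap_cong n hn _).trans ?_
  simp only [opMul_int, nsmul_eq_mul]
  exact Iff.rfl

/-- Every model of the expanded axioms interprets its symbols in the standard way. -/
theorem exists_isCongModel_of_model (hM : M ⊨ discreteDivCongTheory) :
    ∃ (_ : AddCommGroup M) (_ : LinearOrder M) (_ : IsOrderedAddMonoid M) (_ : One M),
      IsCongModel M := by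
  let := groupToCong.reduct M
  have : groupToCong.IsExpansionOn M := LHom.isExpansionOn_reduct _ _
  rw [discreteDivCongTheory, Theory.model_union_iff, LHom.onTheory_model] at hM
  obtain ⟨gp, lo, om, one, hz, h0, h1, hneg, hadd, hmul, hlt⟩ := exists_isZGroup_of_model M hM.1
  refine ⟨gp, lo, om, one, { hz with
    funMap_zero := fun v => (funMap_zero_eq v).trans h0
    funMap_one := fun v => (funMap_one_eq v).trans h1
    funMap_neg := fun v => (funMap_neg_eq v).trans (hneg _)
    funMap_add := fun v => (funMap_add_eq v).trans (hadd _ _)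
    relMap_lt := fun v => (iff_of_eq (relMap_lt_eq v)).trans (hlt _ _)
    relMap_cong := fun n hn v => ?_ }⟩
  have := (realize_axCong n hn).1 (hM.2.realize_of_mem _ ⟨n, hn, rfl⟩) (v 0) (v 1)
  have hv : v = ![v 0, v 1] := funext (Fin.forall_fin_two.2 ⟨rfl, rfl⟩)
  rw [← hv] at this
  simpa only [hadd, hmul] using this

end Expansion

/-- The expansion of a structure for the language of ordered groups by the congruences. -/
@[reducible] def congExpansion (M : Type) [LGroup.Structure M] : LCong.Structure M where
  funMap := fun f v => Structure.funMap (L := LGroup) f v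
  RelMap := fun r v => match r, v with
    | .lt, v => Structure.RelMap (L := LGroup) (n := 2) OrdRel.lt v
    | .cong n _, v => ∃ c, opAdd (v 0) (opMul n c) = v 1

/-- Every model of the axioms can be expanded to a model of the expanded axioms. -/
theorem exists_expansion_of_model (M : Type) [LGroup.Structure M] (hM : M ⊨ discreteDivTheory) :
    ∃ _ : LCong.Structure M, groupToCong.IsExpansionOn M ∧ M ⊨ discreteDivCongTheory := by
  let := congExpansion M
  have : groupToCong.IsExpansionOn M :=
    { map_onFunction := fun f _ => rfl
      map_onRelation := fun R _ => by cases R; rfl }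
  refine ⟨inferInstance, inferInstance, ?_⟩
  rw [discreteDivCongTheory, Theory.model_union_iff, LHom.onTheory_model]
  refine ⟨hM, ?_⟩
  rw [Theory.model_iff]
  rintro _ ⟨n, hn, rfl⟩
  rw [realize_axCong]
  exact fun a b => Iff.rfl

/-! ### Completeness -/

section Numerals

variable {K : Type*} [AddCommGroup K] [LinearOrder K] [IsOrderedAddMonoid K] [One K] [IsZGroup K]

theorem zsmul_one_pos_iff (w : ℤ) : 0 < w • (1 : K) ↔ 0 < w := by
  have := zsmul_lt_zsmul_iff_left (m := 0) (n := w) (IsZGroup.zero_lt_one (M := K))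
  rwa [zero_zsmul] at this

/-- If q divides w·1, it divides r·1 with r = w mod q. For r > 0 the quotient would be positive,
hence at least 1, giving q ≤ r, a contradiction. -/
theorem exists_zsmul_one_eq_nsmul_iff (w : ℤ) (q : ℕ) (hq : 1 ≤ q) :
    (∃ y : K, w • (1 : K) = q • y) ↔ (q : ℤ) ∣ w := by
  constructor
  · rintro ⟨y, hy⟩
    have h1 := IsZGroup.zero_lt_one (M := K)
    have hr0 := Int.emod_nonneg w (b := q) (by omega)
    have hrq := Int.emod_lt_of_pos w (b := q) (by omega)
    have hw := Int.mul_ediv_add_emod w q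
    have key : q • (y - (w / q) • (1 : K)) = (w % q) • (1 : K) := by
      have h : w • (1 : K) = (q * (w / q) + w % q) • (1 : K) := by rw [hw]
      rw [add_smul, mul_smul, hy, natCast_zsmul] at h
      rw [smul_sub, h]
      abel
    rw [Int.dvd_iff_emod_eq_zero]
    by_contra hne
    have hpos : 0 < (w % q) • (1 : K) := (zsmul_one_pos_iff _).2 (by omega)
    rw [← key, smul_pos_iff_of_pos_left (by omega)] at hpos
    have hle := nsmul_le_nsmul_right (IsZGroup.one_le_of_pos _ hpos) q
    rw [key, ← natCast_zsmul, zsmul_le_zsmul_iff_left h1] at hle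
    omega
  · rintro ⟨d, rfl⟩
    exact ⟨d • 1, by rw [mul_smul, natCast_zsmul]⟩

end Numerals

theorem agree_of_isEmpty {M M' ι : Type} [Fintype ι] [IsEmpty ι]
    [AddCommGroup M] [LinearOrder M] [IsOrderedAddMonoid M] [One M] [IsZGroup M]
    [AddCommGroup M'] [LinearOrder M'] [IsOrderedAddMonoid M'] [One M'] [IsZGroup M']
    (N : ℕ) (a : ι → M) (b : ι → M') : Agree N a b := by
  intro c w _
  simp only [linForm, Finset.univ_eq_empty, Finset.sum_empty, zero_add]
  refine ⟨by rw [zsmul_one_pos_iff, zsmul_one_pos_iff], fun q hq _ => ?_⟩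
  rw [exists_zsmul_one_eq_nsmul_iff w q hq, exists_zsmul_one_eq_nsmul_iff w q hq]

theorem realize_sentence_iff_int (φ : LCong.Sentence) (M : Type) [LCong.Structure M]
    (hM : M ⊨ discreteDivCongTheory) : M ⊨ φ ↔ ℤ ⊨ φ := by
  obtain ⟨_, _, _, _, _⟩ := exists_isCongModel_of_model hM
  exact Agree.realize_iff φ le_rfl (agree_of_isEmpty _ _ _)

theorem discreteDivCongTheory_models_iff (φ : LCong.Sentence) :
    discreteDivCongTheory ⊨ᵇ φ ↔ ℤ ⊨ φ := by
  rw [Theory.models_sentence_iff]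
  refine ⟨fun h => h (Theory.ModelType.of _ ℤ), fun h M => ?_⟩
  exact (realize_sentence_iff_int φ M M.is_model).2 h

theorem discreteDivTheory_models_iff (φ : LGroup.Sentence) :
    discreteDivTheory ⊨ᵇ φ ↔ ℤ ⊨ φ := by
  rw [Theory.models_sentence_iff]
  refine ⟨fun h => h (Theory.ModelType.of _ ℤ), fun h M => ?_⟩
  obtain ⟨_, _, hM⟩ := exists_expansion_of_model M M.is_model
  rw [← groupToCong.realize_onSentence M, realize_sentence_iff_int _ M hM,
    groupToCong.realize_onSentence ℤ]
  exact h

/-! ### Quantifier elimination -/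

section QE

theorem isQF_foldr_sup {L : FirstOrder.Language.{0, 0}} {α : Type} {n : ℕ}
    (l : List (L.BoundedFormula α n)) (h : ∀ φ ∈ l, φ.IsQF) : (l.foldr (· ⊔ ·) ⊥).IsQF := by
  induction l with
  | nil => exact BoundedFormula.isQF_bot
  | cons φ l ih =>
    exact (h φ (by simp)).sup (ih fun ψ hψ => h ψ (List.mem_cons_of_mem _ hψ))

theorem isQF_foldr_inf {L : FirstOrder.Language.{0, 0}} {α : Type} {n : ℕ}
    (l : List (L.BoundedFormula α n)) (h : ∀ φ ∈ l, φ.IsQF) : (l.foldr (· ⊓ ·) ⊤).IsQF := by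
  induction l with
  | nil => exact BoundedFormula.IsQF.top
  | cons φ l ih =>
    exact (h φ (by simp)).inf (ih fun ψ hψ => h ψ (List.mem_cons_of_mem _ hψ))

/-- A formula whose truth depends only on the truth of finitely many quantifier-free formulas is
equivalent to a quantifier-free formula. -/
theorem exists_isQF_of_determined {L : FirstOrder.Language.{0, 0}} {T : L.Theory} {k : ℕ}
    (φ : L.Formula (Fin k)) {J : Type} [Finite J] (ψ : J → L.Formula (Fin k))
    (hψ : ∀ j, BoundedFormula.IsQF (ψ j))
    (h : ∀ (M M' : Theory.ModelType.{0, 0, 0} T) (v : Fin k → M) (v' : Fin k → M'),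
      (∀ j, (ψ j).Realize v ↔ (ψ j).Realize v') → φ.Realize v → φ.Realize v') :
    ∃ χ : L.Formula (Fin k), BoundedFormula.IsQF χ ∧ T ⊨ᵇ BoundedFormula.iff φ χ := by
  classical
  -- The good sets are the exact truth patterns of the ψ j at tuples satisfying φ. The disjunction
  -- over them of the corresponding conjunctions of literals is equivalent to φ.
  let good : Set J → Prop := fun S => ∃ (M : Theory.ModelType.{0, 0, 0} T) (v : Fin k → M),
    φ.Realize v ∧ ∀ j, j ∈ S ↔ (ψ j).Realize v
  let conj : Set J → L.Formula (Fin k) := fun S =>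
    BoundedFormula.iInf fun j => if j ∈ S then ψ j else (ψ j).not
  have hconj : ∀ S (M : Theory.ModelType.{0, 0, 0} T) (v : Fin k → M),
      (conj S).Realize v ↔ ∀ j, j ∈ S ↔ (ψ j).Realize v := by
    intro S M v
    rw [Formula.Realize, BoundedFormula.realize_iInf]
    refine forall_congr' fun j => ?_
    by_cases hj : j ∈ S
    · simp only [hj, if_true, true_iff]; rfl
    · simp only [hj, if_false, false_iff]; exact BoundedFormula.realize_not
  refine ⟨BoundedFormula.iSup fun S : {S // good S} => conj S, ?_, ?_⟩
  · refine isQF_foldr_sup _ fun θ hθ => ?_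
    obtain ⟨S, -, rfl⟩ := List.mem_map.1 hθ
    refine isQF_foldr_inf _ fun θ hθ => ?_
    obtain ⟨j, -, rfl⟩ := List.mem_map.1 hθ
    split_ifs
    · exact hψ j
    · exact (hψ j).not
  · refine Theory.models_formula_iff.2 fun M v => ?_
    refine BoundedFormula.realize_iff.2 ?_
    rw [BoundedFormula.realize_iSup]
    constructor
    · intro hφ
      exact ⟨⟨{j | (ψ j).Realize v}, M, v, hφ, fun j => Iff.rfl⟩,
        (hconj _ M v).2 fun j => Iff.rfl⟩
    · rintro ⟨⟨S, M', v', hφ, hS⟩, hv⟩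
      exact h M' M v' v (fun j => (hS j).symm.trans ((hconj S M v).1 hv j)) hφ

/-- Every linear form is the value of a term. -/
theorem exists_term_realize_eq_linForm {β : Type} [Fintype β] (c : β → ℤ) (w : ℤ) :
    ∃ t : LCong.Term β, ∀ (M : Type) [LCong.Structure M] [AddCommGroup M] [LinearOrder M]
      [IsOrderedAddMonoid M] [One M] [IsCongModel M] (v : β → M), t.realize v = linForm c w v := by
  classical
  -- The functions given by one term uniformly in all models contain 0, 1 and the variables and are
  -- closed under negation and addition, which is enough to build every linear form.
  let Rep : (∀ (M : Type) [AddCommGroup M] [One M], (β → M) → M) → Prop := fun F =>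
    ∃ t : LCong.Term β, ∀ (M : Type) [LCong.Structure M] [AddCommGroup M] [LinearOrder M]
      [IsOrderedAddMonoid M] [One M] [IsCongModel M] (v : β → M), t.realize v = F M v
  have h0 : Rep fun M _ _ _ => 0 := ⟨Term.func (l := 0) GroupFunc.zero Fin.elim0,
    fun M _ _ _ _ _ _ v => IsCongModel.funMap_zero _⟩
  have h1 : Rep fun M _ _ _ => 1 := ⟨Term.func (l := 0) GroupFunc.one Fin.elim0,
    fun M _ _ _ _ _ _ v => IsCongModel.funMap_one _⟩
  have hvar : ∀ i, Rep fun M _ _ v => v i := fun i => ⟨Term.var i, by intros; rfl⟩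
  have hneg : ∀ F, Rep F → Rep fun M _ _ v => -F M v := by
    rintro F ⟨t, ht⟩
    refine ⟨Term.func (l := 1) GroupFunc.neg ![t], fun M _ _ _ _ _ _ v => ?_⟩
    refine (IsCongModel.funMap_neg _).trans (congrArg _ (ht M v))
  have hadd : ∀ F G, Rep F → Rep G → Rep fun M _ _ v => F M v + G M v := by
    rintro F G ⟨t, ht⟩ ⟨s, hs⟩
    refine ⟨Term.func (l := 2) GroupFunc.add ![t, s], fun M _ _ _ _ _ _ v => ?_⟩
    exact (IsCongModel.funMap_add _).trans (congrArg₂ _ (ht M v) (hs M v))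
  have hsmul : ∀ (n : ℤ) F, Rep F → Rep fun M _ _ v => n • F M v := by
    intro n F hF
    induction n with
    | zero => simpa only [zero_smul] using h0
    | succ n ih => simpa only [add_smul, one_smul] using hadd _ _ ih hF
    | pred n ih => simpa only [sub_smul, one_smul, ← sub_eq_add_neg] using hadd _ _ ih (hneg _ hF)
  have hsum : ∀ s : Finset β, Rep fun M _ _ v => ∑ i ∈ s, c i • v i := by
    intro s
    induction s using Finset.induction_on with
    | empty => simpa only [Finset.sum_empty] using h0
    | insert i s hi ih =>
      simpa only [Finset.sum_insert hi] using hadd _ _ (hsmul (c i) _ (hvar i)) ih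
  exact hadd _ _ (hsum Finset.univ) (hsmul w _ h1)

theorem admitsQE_of_isCongModel {T : LCong.Theory}
    (hT : ∀ M : Theory.ModelType.{0, 0, 0} T, ∃ (_ : AddCommGroup M) (_ : LinearOrder M) (_ : IsOrderedAddMonoid M)
      (_ : One M), IsCongModel M) : AdmitsQE T := by
  classical
  intro k φ
  choose tm htm using exists_term_realize_eq_linForm (β := Fin k ⊕ Fin 0)
  have tz := htm 0 0
  let N := rank φ
  let ψ : {p : ((Fin k ⊕ Fin 0) → ℤ) × ℤ // CoeffBound N p.1 p.2} × Fin (N + 1) →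
      LCong.Formula (Fin k) := fun p =>
    -- An index q ≥ 2 tests divisibility of the form by q; the indices 0 and 1 are free to test its
    -- sign, since divisibility by 1 is trivial.
    if hq : 2 ≤ (p.2 : ℕ) then
      BoundedFormula.rel (l := 2) (CongRel.cong p.2 hq) ![tm 0 0, tm p.1.1.1 p.1.1.2]
    else BoundedFormula.rel (l := 2) CongRel.lt ![tm 0 0, tm p.1.1.1 p.1.1.2]
  have : Finite {p : ((Fin k ⊕ Fin 0) → ℤ) × ℤ // CoeffBound N p.1 p.2} :=
    (finite_setOf_coeffBound N).to_subtype
  refine exists_isQF_of_determined φ ψ (fun p => ?_) fun M M' v v' h hφ => ?_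
  · simp only [ψ]
    split_ifs
    · exact (BoundedFormula.IsAtomic.rel _ _).isQF
    · exact (BoundedFormula.IsAtomic.rel _ _).isQF
  · obtain ⟨_, _, _, _, _⟩ := hT M
    obtain ⟨_, _, _, _, _⟩ := hT M'
    have hlt : ∀ (K : Type) [LCong.Structure K] [AddCommGroup K] [LinearOrder K]
        [IsOrderedAddMonoid K] [One K] [IsCongModel K] (u : Fin k → K) p, ¬ 2 ≤ (p.2 : ℕ) →
        ((ψ p).Realize u ↔ 0 < linForm p.1.1.1 p.1.1.2 (Sum.elim u (default : Fin 0 → K))) := by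
      intro K _ _ _ _ _ _ u p hp
      simp only [ψ, dif_neg hp]
      refine (IsCongModel.relMap_lt _).trans ?_
      change (tm 0 0).realize _ < (tm p.1.1.1 p.1.1.2).realize _ ↔ _
      rw [htm, htm, linForm_zero_zero]
    have hcong : ∀ (K : Type) [LCong.Structure K] [AddCommGroup K] [LinearOrder K]
        [IsOrderedAddMonoid K] [One K] [IsCongModel K] (u : Fin k → K) p, 2 ≤ (p.2 : ℕ) →
        ((ψ p).Realize u ↔
          ∃ y, linForm p.1.1.1 p.1.1.2 (Sum.elim u (default : Fin 0 → K)) = (p.2 : ℕ) • y) := by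
      intro K _ _ _ _ _ _ u p hp
      simp only [ψ, dif_pos hp]
      refine (IsCongModel.relMap_cong _ _ _).trans ?_
      change (∃ z, (tm 0 0).realize _ + (p.2 : ℕ) • z = (tm p.1.1.1 p.1.1.2).realize _) ↔ _
      simp only [htm, linForm_zero_zero, zero_add, eq_comm]
    suffices key : Agree N (Sum.elim v (default : Fin 0 → M))
        (Sum.elim v' (default : Fin 0 → M')) from (Agree.realize_iff φ le_rfl key).1 hφ
    refine fun c w hc => ⟨?_, fun q hq hqN => ?_⟩
    · have := h ⟨⟨(c, w), hc⟩, 0⟩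
      rwa [hlt _ _ _ (by simp), hlt _ _ _ (by simp)] at this
    · rcases hq.eq_or_lt with rfl | hq
      · simp
      · have := h ⟨⟨(c, w), hc⟩, ⟨q, by omega⟩⟩
        rwa [hcong _ _ ⟨⟨(c, w), hc⟩, ⟨q, by omega⟩⟩ hq,
          hcong _ _ ⟨⟨(c, w), hc⟩, ⟨q, by omega⟩⟩ hq] at this

theorem admitsQE_discreteDivCongTheory : AdmitsQE discreteDivCongTheory :=
  admitsQE_of_isCongModel fun M => exists_isCongModel_of_model M.is_model

theorem admitsQE_completeTheory_int : AdmitsQE (LCong.completeTheory ℤ) :=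
  admitsQE_of_isCongModel fun M => exists_isCongModel_of_model
    (M.is_model.mono (Theory.model_iff_subset_completeTheory.1 inferInstance))

end QE

/-! ### Recursion on a measure -/

section TreeRec

variable {β σ : Type} (m : β → ℕ) (l : β → List β) (g : β → List σ → σ)

/-- Recursion in which the value at `b` is computed from the values at the members of `l b`, all of
which have smaller measure. -/
def treeRec (ord : ∀ b, ∀ b' ∈ l b, m b' < m b) (b : β) : σ :=
  g b ((l b).attach.map fun b' => treeRec ord b'.1)
termination_by m b
decreasing_by exact ord b b'.1 b'.2

theorem treeRec_eq (ord : ∀ b, ∀ b' ∈ l b, m b' < m b) (b : β) :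
    treeRec m l g ord b = g b ((l b).map (treeRec m l g ord)) := by
  rw [treeRec, List.map_attach_eq_pmap, List.pmap_eq_map]

theorem primrec_treeRec [Primcodable β] [Primcodable σ] (hm : Primrec m) (hl : Primrec l)
    (hg : Primrec₂ g) (ord : ∀ b, ∀ b' ∈ l b, m b' < m b) : Primrec (treeRec m l g ord) :=
  Primrec.nat_omega_rec' _ hm hl (Primrec.option_some.comp₂ hg) ord fun b =>
    congrArg some (treeRec_eq m l g ord b).symm

end TreeRec

/-! ### Evaluation of terms from their codes -/

/-- A pair of natural numbers, read as the difference of its components. -/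
def diff (p : ℕ × ℕ) : ℤ := (p.1 : ℤ) - p.2

/-- The list of natural numbers with a given code. -/
def argList (e : ℕ) : List ℕ := Denumerable.ofNat (List ℕ) e

@[simp] theorem argList_encode (l : List ℕ) : argList (Encodable.encode l) = l :=
  Denumerable.ofNat_encode l

theorem lt_encode_of_mem {l : List ℕ} {a : ℕ} (h : a ∈ l) : a < Encodable.encode l := by
  induction l with
  | nil => simp at h
  | cons b l ih =>
    rw [Encodable.encode_list_cons]
    have := Nat.add_le_pair b (Encodable.encode l)
    simp only [Encodable.encode_nat]
    rcases List.mem_cons.1 h with rfl | h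
    · omega
    · have := ih h
      omega

theorem lt_of_mem_argList {e a : ℕ} (h : a ∈ argList e) : a < e := by
  have := lt_encode_of_mem h
  rwa [argList, Denumerable.encode_ofNat] at this

theorem primrec_argList : Primrec argList := Primrec.ofNat _

/-- Codes of terms or formulas, together with an assignment. -/
abbrev Query := ℕ × List (ℕ × ℕ)

/-- The subterms to be evaluated. -/
def termCalls (b : Query) : List Query :=
  (argList b.1.unpair.2.unpair.2).map fun c => (c, b.2)

/-- The value of a term, given the values of its immediate subterms. -/
def termStep (b : Query) (res : List (ℕ × ℕ)) : ℕ × ℕ :=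
  -- The tag is 0 for a variable and otherwise the arity plus one. The number of each constant
  -- symbol is its value, and negation swaps the two components.
  if b.1.unpair.1 = 0 then b.2.getD b.1.unpair.2 (0, 0)
  else if b.1.unpair.1 = 1 then (b.1.unpair.2.unpair.1, 0)
  else if b.1.unpair.1 = 2 then ((res.getD 0 (0, 0)).2, (res.getD 0 (0, 0)).1)
  else ((res.getD 0 (0, 0)).1 + (res.getD 1 (0, 0)).1, (res.getD 0 (0, 0)).2 + (res.getD 1 (0, 0)).2)

theorem termCalls_ord (b : Query) : ∀ b' ∈ termCalls b, b'.1 < b.1 := by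
  intro b' h
  obtain ⟨c, hc, rfl⟩ := List.mem_map.1 h
  exact (lt_of_mem_argList hc).trans_le
    ((Nat.unpair_right_le _).trans (Nat.unpair_right_le _))

/-- The value, as a difference, of the term with a given code. -/
def termValue : Query → ℕ × ℕ := treeRec Prod.fst termCalls termStep termCalls_ord

section Primrec

open Primrec

theorem primrec_unpair_fst {α : Type} [Primcodable α] {f : α → ℕ} (hf : Primrec f) :
    Primrec fun a => (f a).unpair.1 := fst.comp (unpair.comp hf)

theorem primrec_unpair_snd {α : Type} [Primcodable α] {f : α → ℕ} (hf : Primrec f) :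
    Primrec fun a => (f a).unpair.2 := snd.comp (unpair.comp hf)

theorem primrec_getD {α σ : Type} [Primcodable α] [Primcodable σ] {f : α → List σ} {k : α → ℕ}
    (d : σ) (hf : Primrec f) (hk : Primrec k) : Primrec fun a => (f a).getD (k a) d :=
  (list_getD d).comp hf hk

theorem primrecPred_eq_const {α : Type} [Primcodable α] {f : α → ℕ} (hf : Primrec f) (k : ℕ) :
    PrimrecPred fun a => f a = k := Primrec.eq.comp hf (const k)

theorem primrec_termValue : Primrec termValue := by
  refine primrec_treeRec _ _ _ fst ?_ ?_ _
  · exact list_map (primrec_argList.comp (primrec_unpair_snd (primrec_unpair_snd fst)))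
      (Primrec.pair snd (snd.comp fst)).to₂
  · have hb : Primrec fun p : Query × List (ℕ × ℕ) => p.1.1 := fst.comp fst
    have h0 : Primrec fun p : Query × List (ℕ × ℕ) => p.2.getD 0 (0, 0) :=
      primrec_getD _ snd (const 0)
    have h1 : Primrec fun p : Query × List (ℕ × ℕ) => p.2.getD 1 (0, 0) :=
      primrec_getD _ snd (const 1)
    have htag := primrec_unpair_fst hb
    refine Primrec.ite (primrecPred_eq_const htag 0)
      (primrec_getD _ (snd.comp fst) (primrec_unpair_snd hb)) ?_
    refine Primrec.ite (primrecPred_eq_const htag 1)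
      (Primrec.pair (primrec_unpair_fst (primrec_unpair_snd hb)) (const 0)) ?_
    exact Primrec.ite (primrecPred_eq_const htag 2) (Primrec.pair (snd.comp h0) (fst.comp h0))
      (Primrec.pair (nat_add.comp (fst.comp h0) (fst.comp h1))
        (nat_add.comp (snd.comp h0) (snd.comp h1)))

end Primrec

/-- The assignment of integers given by a list. -/
def assignment (n : ℕ) (v : List (ℕ × ℕ)) (i : Fin n) : ℤ := diff (v.getD i (0, 0))

theorem termValue_termCode {n : ℕ} (t : LCong.Term (Empty ⊕ Fin n)) (v : List (ℕ × ℕ)) :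
    diff (termValue (termCode t, v)) =
      t.realize (Sum.elim (default : Empty → ℤ) (assignment n v)) := by
  induction t with
  | var i =>
    rcases i with i | i
    · exact i.elim
    · rw [termValue, treeRec_eq]
      simp [termStep, termCode, assignment]
  | @func l f ts ih =>
    have key : ∀ i, diff (((termCalls (termCode (Term.func f ts), v)).map termValue).getD i (0, 0)) =
        if h : i < l then (ts ⟨i, h⟩).realize (Sum.elim default (assignment n v)) else 0 := by
      intro i
      split_ifs with h
      · rw [← ih]
        simp [termCalls, termCode, List.getD_eq_getElem?_getD, h]
      · simp [termCalls, termCode, List.getD_eq_getElem?_getD, h, diff]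
    rw [termValue, treeRec_eq, ← termValue]
    have k0 := key 0
    have k1 := key 1
    generalize (termCalls (termCode (Term.func f ts), v)).map termValue = res at k0 k1
    change GroupFunc l at f
    cases f with
    | zero =>
      refine Eq.trans ?_ (IsCongModel.funMap_zero _).symm
      simp [termStep, termCode, diff, Numbering.func]
    | one =>
      refine Eq.trans ?_ (IsCongModel.funMap_one _).symm
      simp [termStep, termCode, diff, Numbering.func]
    | neg =>
      refine Eq.trans ?_ (IsCongModel.funMap_neg _).symm
      simp only [zero_lt_one, dif_pos] at k0
      refine Eq.trans ?_ (congrArg _ k0)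
      simp [termStep, termCode, diff]
    | add =>
      refine Eq.trans ?_ (IsCongModel.funMap_add _).symm
      simp only [zero_lt_two, one_lt_two, dif_pos] at k0 k1
      refine Eq.trans ?_ (congrArg₂ _ k0 k1)
      simp [termStep, termCode, diff]
      ring

/-! ### Bounds from codes -/

/-- A bound for the rank of the formula with a given code. -/
def rankBound : ℕ → ℕ
  | 0 => 1
  | c + 1 => agreeStep (rankBound c) + c + 2

theorem rankBound_mono : Monotone rankBound :=
  monotone_nat_of_le_succ fun c => by
    have := le_agreeStep (rankBound c)
    rw [rankBound]
    omega

theorem lt_rankBound (c : ℕ) : c < rankBound c := by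
  cases c with
  | zero => simp [rankBound]
  | succ c => rw [rankBound]; omega

theorem sum_le_encode_ofFn {l : ℕ} (f s : Fin l → ℕ) (h : ∀ i, s i ≤ f i + 1) :
    ∑ i, s i ≤ Encodable.encode (List.ofFn f) := by
  induction l with
  | zero => simp
  | succ l ih =>
    rw [Fin.sum_univ_succ, List.ofFn_succ, Encodable.encode_list_cons]
    have h1 := ih (fun i => f i.succ) (fun i => s i.succ) fun i => h _
    have h2 := Nat.add_le_pair (f 0) (Encodable.encode (List.ofFn fun i => f (Fin.succ i)))
    have h3 := h 0
    simp only [Encodable.encode_nat]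
    omega

/-- The extra 1 is needed because the variable x₀ has code 0; in a list of arguments it is absorbed
by the successor in the encoding of each cons. -/
theorem termSize_le {L : FirstOrder.Language.{0, 0}} [Numbering L] {n : ℕ}
    (t : L.Term (Empty ⊕ Fin n)) : termSize t ≤ termCode t + 1 := by
  induction t with
  | var i =>
    rcases i with i | i
    · exact i.elim
    · simp [termSize]
  | @func l f ts ih =>
    have h := sum_le_encode_ofFn _ _ ih
    rw [termSize, termCode]
    have h1 := Nat.add_le_pair (Numbering.func f)
      (Encodable.encode (List.ofFn fun i => termCode (ts i)))
    have h2 := Nat.add_le_pair (l + 1) (Nat.pair (Numbering.func f)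
      (Encodable.encode (List.ofFn fun i => termCode (ts i))))
    omega

theorem rank_le {L : FirstOrder.Language.{0, 0}} [Numbering L] {n : ℕ}
    (φ : L.BoundedFormula Empty n) : rank φ ≤ rankBound (formulaCode φ) := by
  induction φ with
  | falsum => simp [rank]
  | equal s t =>
    refine le_trans ?_ (Nat.succ_le_of_lt (lt_rankBound _))
    have h1 := termSize_le s
    have h2 := termSize_le t
    have h3 := Nat.add_le_pair (termCode s) (termCode t)
    have h4 := Nat.add_le_pair 1 (Nat.pair (termCode s) (termCode t))
    rw [rank, formulaCode]
    omega
  | @rel n l r ts =>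
    refine le_trans ?_ (lt_rankBound _).le
    have h := sum_le_encode_ofFn _ _ fun i => termSize_le (ts i)
    rw [rank, formulaCode]
    have h1 := Nat.add_le_pair (Numbering.rel r)
      (Encodable.encode (List.ofFn fun i => termCode (ts i)))
    have h2 := Nat.add_le_pair l (Nat.pair (Numbering.rel r)
      (Encodable.encode (List.ofFn fun i => termCode (ts i))))
    have h3 := Nat.add_le_pair 2 (Nat.pair l (Nat.pair (Numbering.rel r)
      (Encodable.encode (List.ofFn fun i => termCode (ts i)))))
    omega
  | imp φ ψ ih1 ih2 =>
    have h3 := Nat.add_le_pair (formulaCode φ) (formulaCode ψ)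
    have h4 := Nat.add_le_pair 3 (Nat.pair (formulaCode φ) (formulaCode ψ))
    rw [rank, formulaCode]
    exact max_le (ih1.trans (rankBound_mono (by omega))) (ih2.trans (rankBound_mono (by omega)))
  | all φ ih =>
    have h4 := Nat.add_le_pair 4 (formulaCode φ)
    rw [rank, formulaCode]
    refine le_trans ?_ (rankBound_mono (show formulaCode φ + 1 ≤ _ by omega))
    rw [rankBound]
    have : agreeStep (rank φ) ≤ agreeStep (rankBound (formulaCode φ)) := by
      unfold agreeStep
      have := Nat.factorial_le ih
      gcongr
    omega

/-! ### Bounded quantifiers -/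

/-- The sum of all the entries of an assignment. -/
def weight (v : List (ℕ × ℕ)) : ℕ := (v.map fun p => p.1 + p.2).sum

theorem sum_abs_assignment_le (v : List (ℕ × ℕ)) :
    ∑ i, |assignment v.length v i| ≤ weight v := by
  have h : (weight v : ℤ) = ∑ i : Fin v.length, ((v[(i : ℕ)].1 + v[(i : ℕ)].2 : ℕ) : ℤ) := by
    rw [weight, ← Nat.cast_sum, Fin.sum_univ_fun_getElem v fun p => p.1 + p.2]
  rw [h]
  refine Finset.sum_le_sum fun i _ => ?_
  have : assignment v.length v i = diff v[(i : ℕ)] := by simp [assignment]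
  rw [this, diff, abs_le]
  push_cast
  constructor <;> omega

/-- A bound for the witnesses that have to be considered for a quantifier. -/
def witnessBound (N S : ℕ) : ℕ := N.factorial * N * (S + 1) + 2 * N.factorial ^ 2

theorem abs_linForm_le {ι : Type} [Fintype ι] {C : ℕ} {c : ι → ℤ} {w : ℤ} (hc : CoeffBound C c w)
    (a : ι → ℤ) : |linForm c w a| ≤ C * (∑ i, |a i| + 1) := by
  rw [linForm, mul_add, Finset.mul_sum]
  refine (abs_add_le _ _).trans (add_le_add ((Finset.abs_sum_le_sum_abs _ _).trans
    (Finset.sum_le_sum fun i _ => ?_)) ?_)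
  · rw [smul_eq_mul, abs_mul]
    exact mul_le_mul_of_nonneg_right (hc.1 i) (abs_nonneg _)
  · simpa using hc.2

/-- The replacement x' of x agrees with it over the parameters, so φ holds at both or neither. In ℤ,
|x'| ≤ |N!·x'|, and the right side is a form of bounded coefficients plus a bounded constant. -/
theorem forall_realize_of_forall_le {n : ℕ} (φ : LCong.BoundedFormula Empty (n + 1)) {N : ℕ}
    (hN : rank φ ≤ N) (u : Empty → ℤ) (xs : Fin n → ℤ) {S : ℕ} (hS : ∑ i, |xs i| ≤ S)
    (h : ∀ x : ℤ, |x| ≤ witnessBound N S → φ.Realize u (Fin.snoc xs x)) (x : ℤ) :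
    φ.Realize u (Fin.snoc xs x) := by
  obtain ⟨c, w, s, x', hc, hs, hx', H⟩ := exists_witness N (Sum.elim u xs) x
  refine (Agree.realize_iff φ hN (agree_snoc (v := u) (xs := xs) (v' := u) (xs' := xs) H)).2
    (h x' ?_)
  have h1 : |x'| ≤ |N.factorial • x'| := by
    rw [nsmul_eq_mul, abs_mul, Nat.abs_cast]
    exact le_mul_of_one_le_left (abs_nonneg _) (by exact_mod_cast N.factorial_pos)
  refine h1.trans ?_
  rw [hx', witnessBound]
  push_cast
  refine (abs_add_le _ _).trans (add_le_add ((abs_linForm_le hc _).trans ?_) (by simpa using hs))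
  rw [Fintype.sum_sum_type]
  simp only [Finset.univ_eq_empty, Finset.sum_empty, zero_add, Sum.elim_inr]
  push_cast
  gcongr

/-! ### Evaluation of formulas from their codes -/

/-- The number of values that are tried for a quantifier in front of the formula with code `r`. -/
def witnessRange (r : ℕ) (v : List (ℕ × ℕ)) : ℕ :=
  Nat.pair (witnessBound (rankBound r) (weight v)) (witnessBound (rankBound r) (weight v)) + 1

/-- The subformulas to be evaluated, with their assignments. -/
def formulaCalls (b : Query) : List Query :=
  if b.1.unpair.1 = 3 then [(b.1.unpair.2.unpair.1, b.2), (b.1.unpair.2.unpair.2, b.2)]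
  else if b.1.unpair.1 = 4 then
    (List.range (witnessRange b.1.unpair.2 b.2)).map fun j => (b.1.unpair.2, b.2 ++ [j.unpair])
  else []

/-- The truth value of a formula, given the truth values of the subformulas to be evaluated. -/
def formulaStep (b : Query) (res : List Bool) : Bool :=
  let r := b.1.unpair.2
  let args := argList r.unpair.2.unpair.2
  let s := termValue (args.getD 0 0, b.2)
  let t := termValue (args.getD 1 0, b.2)
  if b.1.unpair.1 = 0 then false
  else if b.1.unpair.1 = 1 then
    decide ((termValue (r.unpair.1, b.2)).1 + (termValue (r.unpair.2, b.2)).2 =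
      (termValue (r.unpair.2, b.2)).1 + (termValue (r.unpair.1, b.2)).2)
  else if b.1.unpair.1 = 2 then
    -- Relation number 0 is the order and q ≥ 2 is congruence modulo q. Cross-adding components
    -- compares the differences within ℕ.
    if r.unpair.2.unpair.1 = 0 then decide (s.1 + t.2 < t.1 + s.2)
    else decide ((s.1 + t.2) % r.unpair.2.unpair.1 = (t.1 + s.2) % r.unpair.2.unpair.1)
  else if b.1.unpair.1 = 3 then !(res.getD 0 false) || res.getD 1 false
  else decide (∀ p ∈ res, p = true)

theorem formulaCalls_ord (b : Query) : ∀ b' ∈ formulaCalls b, b'.1 < b.1 := by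
  intro b' h
  have h1 := Nat.unpair_add_le b.1
  have h2 := Nat.unpair_add_le b.1.unpair.2
  unfold formulaCalls at h
  split_ifs at h with h3 h4
  · simp only [List.mem_cons, List.not_mem_nil, or_false] at h
    rcases h with rfl | rfl
    · dsimp only; omega
    · dsimp only; omega
  · obtain ⟨j, -, rfl⟩ := List.mem_map.1 h
    dsimp only; omega
  · simp at h

/-- The truth value in `ℤ` of the formula with a given code. -/
def formulaValue : Query → Bool := treeRec Prod.fst formulaCalls formulaStep formulaCalls_ord

section Primrec

open Primrec

theorem primrec_factorial : Primrec Nat.factorial := by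
  refine (nat_rec₁ 1 (f := fun n ih => (n + 1) * ih)
    (nat_mul.comp (succ.comp fst) snd).to₂).of_eq fun n => ?_
  induction n with
  | zero => rfl
  | succ n ih =>
    change (n + 1) * _ = _
    rw [ih, Nat.factorial_succ]

theorem primrec_agreeStep : Primrec agreeStep := by
  have hP := primrec_factorial
  have hPN := nat_mul.comp hP Primrec.id
  have hC := nat_add.comp hPN (nat_mul.comp (const 2) (nat_mul.comp hP hP))
  refine (nat_add.comp (nat_add.comp (nat_add.comp (nat_mul.comp Primrec.id hC) hPN) hC)
    hP).of_eq fun n => ?_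
  simp only [agreeStep, id, pow_two]

theorem primrec_rankBound : Primrec rankBound := by
  refine (nat_rec₁ 1 (f := fun c ih => agreeStep ih + c + 2)
    (nat_add.comp (nat_add.comp (primrec_agreeStep.comp snd) fst) (const 2)).to₂).of_eq
    fun n => ?_
  induction n with
  | zero => rfl
  | succ n ih =>
    change agreeStep _ + n + 2 = _
    rw [ih, rankBound]

theorem primrec_witnessBound : Primrec₂ witnessBound := by
  have hP : Primrec fun p : ℕ × ℕ => p.1.factorial := primrec_factorial.comp fst
  refine (nat_add.comp (nat_mul.comp (nat_mul.comp hP fst) (succ.comp snd))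
    (nat_mul.comp (const 2) (nat_mul.comp hP hP))).of_eq fun p => ?_
  simp only [witnessBound, pow_two, Nat.succ_eq_add_one]

theorem primrec_weight : Primrec weight := by
  refine (list_foldr (f := fun v : List (ℕ × ℕ) => v) (g := fun _ => 0)
    (h := fun _ q => q.1.1 + q.1.2 + q.2) Primrec.id (const 0) ?_).of_eq fun v => ?_
  · have : Primrec fun p : List (ℕ × ℕ) × ((ℕ × ℕ) × ℕ) => p.2.1 := fst.comp snd
    exact (nat_add.comp (nat_add.comp (fst.comp this) (snd.comp this)) (snd.comp snd)).to₂
  · induction v with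
    | nil => rfl
    | cons p v ih => simpa [weight] using ih

theorem primrec_witnessRange : Primrec₂ witnessRange := by
  have h : Primrec fun p : ℕ × List (ℕ × ℕ) => witnessBound (rankBound p.1) (weight p.2) :=
    primrec_witnessBound.comp (primrec_rankBound.comp fst) (primrec_weight.comp snd)
  exact succ.comp (Primrec₂.natPair.comp h h)

theorem primrec_formulaCalls : Primrec formulaCalls := by
  have htag : Primrec fun b : Query => b.1.unpair.1 := primrec_unpair_fst fst
  have hr : Primrec fun b : Query => b.1.unpair.2 := primrec_unpair_snd fst
  refine Primrec.ite (primrecPred_eq_const htag 3) ?_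
    (Primrec.ite (primrecPred_eq_const htag 4) ?_ (const []))
  · exact list_cons.comp (Primrec.pair (primrec_unpair_fst hr) snd)
      (list_cons.comp (Primrec.pair (primrec_unpair_snd hr) snd) (const []))
  · refine list_map (list_range.comp (primrec_witnessRange.comp hr snd)) ?_
    exact (Primrec.pair (hr.comp fst)
      (list_concat.comp (snd.comp fst) (unpair.comp snd))).to₂

theorem primrec_formulaStep : Primrec₂ formulaStep := by
  have htag : Primrec fun p : Query × List Bool => p.1.1.unpair.1 :=
    primrec_unpair_fst (fst.comp fst)
  have hr : Primrec fun p : Query × List Bool => p.1.1.unpair.2 :=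
    primrec_unpair_snd (fst.comp fst)
  have hv : Primrec fun p : Query × List Bool => p.1.2 := snd.comp fst
  have hq := primrec_unpair_fst (primrec_unpair_snd hr)
  have hargs := primrec_argList.comp (primrec_unpair_snd (primrec_unpair_snd hr))
  have hterm : ∀ {f : Query × List Bool → ℕ}, Primrec f →
      Primrec fun p : Query × List Bool => termValue (f p, p.1.2) := fun hf =>
    primrec_termValue.comp (Primrec.pair hf hv)
  have hs := hterm (primrec_getD 0 hargs (const 0))
  have ht := hterm (primrec_getD 0 hargs (const 1))
  have hs' := hterm (primrec_unpair_fst hr)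
  have ht' := hterm (primrec_unpair_snd hr)
  have cross : ∀ {f g : Query × List Bool → ℕ × ℕ}, Primrec f → Primrec g →
      Primrec fun p => (f p).1 + (g p).2 := fun hf hg =>
    nat_add.comp (fst.comp hf) (snd.comp hg)
  refine Primrec.ite (primrecPred_eq_const htag 0) (const false) ?_
  refine Primrec.ite (primrecPred_eq_const htag 1)
    (PrimrecPred.decide (Primrec.eq.comp (cross hs' ht') (cross ht' hs'))) ?_
  refine Primrec.ite (primrecPred_eq_const htag 2) (Primrec.ite (primrecPred_eq_const hq 0)
    (PrimrecPred.decide (nat_lt.comp (cross hs ht) (cross ht hs)))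
    (PrimrecPred.decide (Primrec.eq.comp (nat_mod.comp (cross hs ht) hq)
      (nat_mod.comp (cross ht hs) hq)))) ?_
  refine Primrec.ite (primrecPred_eq_const htag 3)
    (Primrec.or.comp (Primrec.not.comp (primrec_getD false snd (const 0)))
      (primrec_getD false snd (const 1))) ?_
  have hall : PrimrecPred fun p : Query × List Bool => ∀ a ∈ p.2, a = true :=
    (PrimrecPred.forall_mem_list (Primrec.eq.comp Primrec.id (const true))).comp snd
  exact hall.decide

theorem primrec_formulaValue : Primrec formulaValue :=
  primrec_treeRec _ _ _ fst primrec_formulaCalls primrec_formulaStep _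

end Primrec

theorem assignment_concat {n : ℕ} {v : List (ℕ × ℕ)} (hv : v.length = n) (p : ℕ × ℕ) :
    assignment (n + 1) (v ++ [p]) = Fin.snoc (assignment n v) (diff p) := by
  subst hv
  funext i
  refine Fin.lastCases ?_ (fun i => ?_) i
  · simp [assignment]
  · simp [assignment]

/-- Pairing is monotone in each argument, so the range contains the code of the positive and
negative parts of x. -/
theorem exists_unpair_eq (x : ℤ) (R : ℕ) (hx : |x| ≤ R) :
    ∃ j < Nat.pair R R + 1, diff j.unpair = x := by
  refine ⟨Nat.pair x.toNat (-x).toNat, ?_, ?_⟩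
  · have hmono : ∀ a b, a ≤ R → b ≤ R → Nat.pair a b < Nat.pair R R + 1 := by
      intro a b ha hb
      have h1 : Nat.pair a b ≤ Nat.pair R b := by
        rcases ha.eq_or_lt with rfl | h
        · exact le_rfl
        · exact (Nat.pair_lt_pair_left b h).le
      have h2 : Nat.pair R b ≤ Nat.pair R R := by
        rcases hb.eq_or_lt with rfl | h
        · exact le_rfl
        · exact (Nat.pair_lt_pair_right R h).le
      omega
    rw [abs_le] at hx
    exact hmono _ _ (by omega) (by omega)
  · rw [Nat.unpair_pair, diff]
    omega

/-- The length condition makes the value appended for a quantifier land on the newly bound variable.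
The finite search is sound because `rankBound` and `weight` dominate the true rank and the size of
the assignment. -/
theorem formulaValue_formulaCode {n : ℕ} (φ : LCong.BoundedFormula Empty n) :
    ∀ v : List (ℕ × ℕ), v.length = n →
      (formulaValue (formulaCode φ, v) = true ↔ φ.Realize default (assignment n v)) := by
  induction φ with
  | falsum =>
    intro v _
    rw [formulaValue, treeRec_eq]
    simp [formulaStep, formulaCode, BoundedFormula.Realize]
  | equal s t =>
    intro v _
    rw [formulaValue, treeRec_eq]
    simp only [BoundedFormula.Realize, ← termValue_termCode]
    simp [formulaStep, formulaCode, diff]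
    omega
  | @rel n l r ts =>
    intro v _
    rw [formulaValue, treeRec_eq]
    change CongRel l at r
    cases r with
    | lt =>
      refine Iff.trans ?_ (IsCongModel.relMap_lt _).symm
      rw [← termValue_termCode, ← termValue_termCode]
      simp only [formulaStep, formulaCode, Nat.unpair_pair, argList_encode]
      simp [diff, Numbering.rel]
      omega
    | cong q hq =>
      have hq0 : q ≠ 0 := by omega
      change _ ↔ (ts 0).realize _ ≡ (ts 1).realize _ [ZMOD q]
      rw [← termValue_termCode, ← termValue_termCode]
      simp only [formulaStep, formulaCode, Nat.unpair_pair, argList_encode]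
      simp [diff, Numbering.rel, hq0]
      change _ ≡ _ [MOD q] ↔ _
      rw [← Int.natCast_modEq_iff, Int.modEq_iff_dvd, Int.modEq_iff_dvd]
      push_cast
      apply iff_of_eq
      congr 1
      ring
  | imp φ ψ ih1 ih2 =>
    intro v hv
    rw [formulaValue, treeRec_eq, ← formulaValue, BoundedFormula.realize_imp, ← ih1 v hv,
      ← ih2 v hv]
    simp [formulaStep, formulaCode, formulaCalls, imp_iff_not_or]
  | @all n φ ih =>
    intro v hv
    rw [formulaValue, treeRec_eq, ← formulaValue, BoundedFormula.realize_all]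
    have h : formulaStep (formulaCode φ.all, v)
        ((formulaCalls (formulaCode φ.all, v)).map formulaValue) = true ↔
        ∀ j < witnessRange (formulaCode φ) v, formulaValue (formulaCode φ, v ++ [j.unpair]) = true := by
      simp [formulaStep, formulaCode, formulaCalls]
    rw [h]
    have h' : ∀ j : ℕ, formulaValue (formulaCode φ, v ++ [j.unpair]) = true ↔
        φ.Realize default (Fin.snoc (assignment n v) (diff j.unpair)) := fun j => by
      rw [ih _ (by simp [hv]), assignment_concat hv]
    simp only [h']
    refine ⟨fun H => ?_, fun H j _ => H _⟩
    subst hv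
    refine forall_realize_of_forall_le φ (rank_le φ) _ _ (sum_abs_assignment_le v) fun x hx => ?_
    obtain ⟨j, hj, rfl⟩ := exists_unpair_eq x _ hx
    exact H j hj

/-! ### Decidability -/

theorem computablePred_formulaValue : ComputablePred fun c => formulaValue (c, []) = true :=
  (PrimrecPred.computablePred (Primrec.eq.comp
    (primrec_formulaValue.comp (Primrec.pair Primrec.id (Primrec.const []))) (Primrec.const true)))

theorem formulaValue_sentence (φ : LCong.Sentence) :
    formulaValue (formulaCode φ, []) = true ↔ ℤ ⊨ φ := by
  rw [formulaValue_formulaCode φ [] rfl]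
  exact iff_of_eq (congrArg₂ (BoundedFormula.Realize φ) (Subsingleton.elim _ _)
    (Subsingleton.elim _ _))

/-- The inclusion `{<, +} ⊆ {<, +, -, 0, 1} ∪ {≡ₙ : n ≥ 2}`. -/
def addToCong : LAdd →ᴸ LCong := groupToCong.comp addToGroup

instance addToCong_isExpansionOn_int : addToCong.IsExpansionOn ℤ where
  map_onFunction f _ := by cases f; rfl
  map_onRelation R _ := by cases R; rfl

theorem termCode_onTerm {n : ℕ} (t : LAdd.Term (Empty ⊕ Fin n)) :
    termCode (addToCong.onTerm t) = termCode t := by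
  induction t with
  | var i =>
    rcases i with i | i
    · exact i.elim
    · rfl
  | @func l f ts ih =>
    change AddFunc l at f
    cases f
    simp only [LHom.onTerm, termCode, ih]
    rfl

/-- The numberings give + and < the same numbers in both languages, so the decision procedure for
the larger language applies verbatim to the smaller one. -/
theorem formulaCode_onBoundedFormula {n : ℕ} (φ : LAdd.BoundedFormula Empty n) :
    formulaCode (addToCong.onBoundedFormula φ) = formulaCode φ := by
  induction φ with
  | falsum => rfl
  | equal s t =>
    rw [formulaCode, ← termCode_onTerm s, ← termCode_onTerm t]
    rfl
  | @rel n l r ts =>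
    change OrdRel l at r
    cases r
    simp only [formulaCode, ← termCode_onTerm]
    rfl
  | imp φ ψ ih1 ih2 => rw [formulaCode, ← ih1, ← ih2]; rfl
  | all φ ih => rw [formulaCode, ← ih]; rfl

theorem hasDecidableTheory_LCong_int : HasDecidableTheory LCong ℤ :=
  ⟨_, computablePred_formulaValue, formulaValue_sentence⟩

theorem hasDecidableTheory_LAdd_int : HasDecidableTheory LAdd ℤ := by
  refine ⟨_, computablePred_formulaValue, fun φ => ?_⟩
  rw [← formulaCode_onBoundedFormula φ, ← addToCong.realize_onSentence ℤ]
  exact formulaValue_sentence _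

end IntOrdAdd

theorem mainTheorem6 :
    (∀ φ : IntOrdAdd.LAdd.Sentence,
      IntOrdAdd.discreteDivTheory ⊨ᵇ IntOrdAdd.addToGroup.onSentence φ ↔ ℤ ⊨ φ) ∧
    (∀ φ : IntOrdAdd.LGroup.Sentence, IntOrdAdd.discreteDivTheory ⊨ᵇ φ ↔ ℤ ⊨ φ) ∧
    (∀ φ : IntOrdAdd.LCong.Sentence, IntOrdAdd.discreteDivCongTheory ⊨ᵇ φ ↔ ℤ ⊨ φ) ∧
    IntOrdAdd.AdmitsQE IntOrdAdd.discreteDivCongTheory ∧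
    IntOrdAdd.AdmitsQE (IntOrdAdd.LCong.completeTheory ℤ) ∧
    IntOrdAdd.HasDecidableTheory IntOrdAdd.LCong ℤ ∧
    IntOrdAdd.HasDecidableTheory IntOrdAdd.LAdd ℤ := by
  refine ⟨fun φ => ?_, IntOrdAdd.discreteDivTheory_models_iff,
    IntOrdAdd.discreteDivCongTheory_models_iff, IntOrdAdd.admitsQE_discreteDivCongTheory,
    IntOrdAdd.admitsQE_completeTheory_int, IntOrdAdd.hasDecidableTheory_LCong_int,
    IntOrdAdd.hasDecidableTheory_LAdd_int⟩
  rw [IntOrdAdd.discreteDivTheory_models_iff, IntOrdAdd.addToGroup.realize_onSentence ℤ]
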